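/- Let $n\ge 1$, $s\in(0,1)$ and $B\ge 0$. There are constants $\alpha\in(0,1)$ and $C>0$, depending only on $n$, $s$ and $B$, such that the following holds. Let $b:B_1\times[-1,0]\to\mathbb R^n$ satisfy $|b(x,t)|\le B$ for all $(x,t)\in B_1\times[-1,0]$, where $B_1$ is the open unit ball of $\mathbb R^n$. If $s<1/2$, assume in addition that $b$ is continuous on $B_1\times[-1,0]$ and $|b(x,t)-b(y,t)|\le B|x-y|^{1-2s}$ for all $x,y\in B_1$ and $t\in[-1,0]$. Let $f:B_1\times[-1,0]\to\mathbb R$ be bounded, and let $u:\mathbb R^n\times[-1,0]\to\mathbb R$ be bounded, with $u(\cdot,t)$ Lebesgue measurable for each $t$. Suppose that $u$ is a classical solution of $$u_t-b\cdot\nabla u+(-\Delta)^s u=f\quad\text{in } B_1\times[-1,0],$$ that is, $u$ is (jointly) differentiable at every point of $B_1\times[-1,0]$ relative to this set, the principal value $$(-\Delta)^s u(x,t)=\frac{4^s\,\Gamma(n/2+s)}{\pi^{n/2}|\Gamma(-s)|}\lim_{\varepsilon\downarrow0}\int_{|y|>\varepsilon}\frac{u(x,t)-u(x+y,t)}{|y|^{n+2s}}\,dy$$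 exists at every such point, and the equation holds at every such point. Then $u$ is $C^\alpha$ at $(0,0)$, with $$|u(x,t)-u(0,0)|\le C\left(|x|^\alpha+|t|^{\alpha/(2s)}\right)\left(\|u\|_{L^\infty}+\|f\|_{L^\infty}\right)\quad\text{for all }x\in\mathbb R^n,\ -1\le t\le 0,$$ where $\|u\|_{L^\infty}$ and $\|f\|_{L^\infty}$ are the suprema of $|u|$ over $\mathbb R^n\times[-1,0]$ and of $|f|$ over $B_1\times[-1,0]$. -/

import Mathlib

open Filter Topology MeasureTheory Set

/-- The standard normalizing constant `4 ^ s Γ(n/2 + s) / (π ^ (n/2) |Γ(-s)|)` of `(-Δ)^s` on `ℝⁿ`,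
written with `|Γ(-s)| = Γ(1 - s) / s` for `0 < s < 1`. -/
noncomputable def fracLaplacianConst (n : ℕ) (s : ℝ) : ℝ :=
  (4 : ℝ) ^ s * s * Real.Gamma ((n : ℝ) / 2 + s) /
    (Real.pi ^ ((n : ℝ) / 2) * Real.Gamma (1 - s))

/-- `(-Δ)^s v (x) = L`: the singular integral
`c_{n,s} PV ∫ (v x - v (x + y)) / |y| ^ (n + 2 s) dy` exists as a principal value and equals `L`.
(Used for bounded Lebesgue measurable `v`, for which each truncated integral converges
absolutely.) -/
def HasFracLaplacianAt {n : ℕ} (s : ℝ) (v : EuclideanSpace ℝ (Fin n) → ℝ)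
    (x : EuclideanSpace ℝ (Fin n)) (L : ℝ) : Prop :=
  Tendsto
    (fun ε : ℝ => fracLaplacianConst n s *
      ∫ y in {y : EuclideanSpace ℝ (Fin n) | ε < ‖y‖},
        (v x - v (x + y)) / ‖y‖ ^ ((n : ℝ) + 2 * s))
    (𝓝[>] 0) (𝓝 L)

/-- `u` is a classical (pointwise) solution of `u_t - b · ∇u + (-Δ)^s u = f` in `B_1 × [-1, 0]`.
At the end times `t = -1` and `t = 0` the time derivative is the one-sided one.
Outside `B_1` only measurability in `x` at each time is asked for. -/
structure IsClassicalSolution {n : ℕ} (s : ℝ)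
    (b : EuclideanSpace ℝ (Fin n) → ℝ → EuclideanSpace ℝ (Fin n))
    (f u : EuclideanSpace ℝ (Fin n) → ℝ → ℝ) : Prop where
  aemeasurable : ∀ t ∈ Icc (-1 : ℝ) 0, AEMeasurable (fun x => u x t) volume
  differentiableOn :
    DifferentiableOn ℝ (fun p : EuclideanSpace ℝ (Fin n) × ℝ => u p.1 p.2)
      (Metric.ball 0 1 ×ˢ Icc (-1) 0)
  equation : ∀ x ∈ Metric.ball (0 : EuclideanSpace ℝ (Fin n)) 1, ∀ t ∈ Icc (-1 : ℝ) 0,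
    ∃ L : ℝ, HasFracLaplacianAt s (fun y => u y t) x L ∧
      derivWithin (fun τ => u x τ) (Icc (-1) 0) t
        - inner ℝ (b x t) (gradient (fun y => u y t) x) + L = f x t

/-! The oscillation of u decays geometrically in shrinking cylinders of radius r = λ^k r₀ and
duration r^(2s), centred on a curve V with V(0) = 0. Seen at unit scale in the frame moving with V,
the drift becomes r^(2s-1) (b + V'), so a bound |b + V'| ≤ A r^(1-2s) is all that is needed. For s ≥
1/2 it holds with V = 0, since then r^(1-2s) ≥ 1. For s < 1/2 the curve nearly solves V' = -b(V, t),
and the Hölder condition on b controls the remainder (`exists_frame`). The rescaled function v then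
satisfies |v_t + (-Δ)^s v| ≤ A|∇v| + ε₀, is bounded by 1 in the unit cylinder and grows slowly
outside (`IsClassicalSolution.rescale`).

The core is `upper_improvement`: if 1 - v has enough mass over B_{1/4} × [-1, -1/2], then v ≤ 1 - θ
on B_{1/4} × [-1/2, 0]. Add to v a barrier m(t)β(x), where β is a cutoff and m is fed by the mass of
1 - v. At a maximum point the nonlocal operator sees this mass, however far away within the ball it
lies. The drift contributes A m|∇β|, and this is harmless for every s: where β is small, |∇β|² ≤ 4Kβ
makes it small while the nonlocal term of β is strictly favourable; elsewhere the decay rate C₁ of m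
pays for it (`cutoff_barrier`). Either v or -v has the required mass, so the oscillation always
drops (`oscillation_improvement`).

Iteration (`oscillation_decay`) gives the Hölder bound, with α so small that the tails inherited
from larger scales stay admissible. -/

/-- Euclidean `n`-space. -/
abbrev Euc (n : ℕ) := EuclideanSpace ℝ (Fin n)

/-! ### Integrability of the kernel, and the cutoff. -/

theorem measurableSet_lt_norm {n : ℕ} (ε : ℝ) : MeasurableSet {y : Euc n | ε < ‖y‖} :=
  measurableSet_lt measurable_const measurable_norm

theorem fracLaplacianConst_pos (n : ℕ) {s : ℝ} (hs0 : 0 < s) (hs1 : s < 1) :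
    0 < fracLaplacianConst n s := by
  have h1 : 0 < Real.Gamma ((n : ℝ) / 2 + s) := Real.Gamma_pos_of_pos (by positivity)
  have h2 : 0 < Real.Gamma (1 - s) := Real.Gamma_pos_of_pos (by linarith)
  unfold fracLaplacianConst
  positivity

/-- The kernel `|y|^{-p}`, `p > n`, is integrable away from the origin. -/
theorem integrableOn_kernel_tail {n : ℕ} {p ε : ℝ} (hp : (n : ℝ) < p) (hε : 0 < ε) :
    IntegrableOn (fun y : Euc n => 1 / ‖y‖ ^ p) {y | ε < ‖y‖} := by
  have h0 : Integrable (fun y : Euc n => (1 + ‖y‖) ^ (-p)) volume :=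
    integrable_one_add_norm (by simpa using hp)
  have hp0 : 0 < p := lt_of_le_of_lt (Nat.cast_nonneg n) hp
  refine ((h0.const_mul ((1 / ε + 1) ^ p)).integrableOn (s := {y | ε < ‖y‖})).mono' ?_ ?_
  · exact (Measurable.aestronglyMeasurable (by fun_prop))
  · refine (ae_restrict_iff' (measurableSet_lt_norm ε)).2 (Eventually.of_forall fun y hy => ?_)
    have hy : ε < ‖y‖ := hy
    have hy0 : 0 < ‖y‖ := hε.trans hy
    rw [Real.norm_of_nonneg (by positivity), Real.rpow_neg (by positivity), ← div_eq_mul_inv,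
      div_le_div_iff₀ (by positivity) (by positivity), one_mul,
      ← Real.mul_rpow (by positivity) (by positivity)]
    refine Real.rpow_le_rpow (by positivity) ?_ hp0.le
    have : 1 ≤ 1 / ε * ‖y‖ := by rw [one_div, ← div_eq_inv_mul, one_le_div hε]; exact hy.le
    linarith

theorem integrableOn_rpow_norm_ball {n : ℕ} (hn : 1 ≤ n) {a : ℝ} (ha : a < n) (r : ℝ) :
    IntegrableOn (fun y : Euc n => ‖y‖ ^ (-a)) (Metric.ball 0 r) := by
  refine integrableOn_ball_of_norm_le_rpow (C := 1) (α := a) (by simpa using hn)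
    (by simpa using ha) (Eventually.of_forall fun y => ?_)
    (Measurable.aestronglyMeasurable (by fun_prop))
  rw [Real.norm_of_nonneg (by positivity), one_mul]

/-- The integral of an odd function over a symmetric set vanishes. -/
theorem setIntegral_eq_zero_of_odd {n : ℕ} {f : Euc n → ℝ} {S : Set (Euc n)}
    (hS : MeasurableSet S) (hSneg : ∀ y, -y ∈ S ↔ y ∈ S) (hf : ∀ y, f (-y) = -f y) :
    ∫ y in S, f y = 0 := by
  have h : ∫ y, S.indicator f y = -∫ y, S.indicator f y := by
    rw [← integral_neg]
    conv_lhs => rw [← integral_neg_eq_self]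
    refine integral_congr_ae (Eventually.of_forall fun y => ?_)
    by_cases hy : y ∈ S
    · simp [indicator, hSneg, hy, hf]
    · simp [indicator, hSneg, hy]
  rw [← integral_indicator hS]
  linarith

/-- A smooth cutoff function together with a quadratic Taylor bound. -/
theorem exists_cutoff (n : ℕ) : ∃ (β : Euc n → ℝ) (G : Euc n → Euc n) (K : ℝ), 0 < K ∧
    Continuous β ∧ (∀ x, 0 ≤ β x) ∧ (∀ x, β x ≤ 1) ∧ (∀ x, ‖x‖ ≤ 1 / 4 → β x = 1) ∧
    (∀ x, 1 / 2 ≤ ‖x‖ → β x = 0) ∧ (∀ x, HasGradientAt β (G x) x) ∧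
    ∀ x y, |β (x + y) - β x - inner ℝ (G x) y| ≤ K * ‖y‖ ^ 2 := by
  let β : ContDiffBump (0 : Euc n) := ⟨1 / 4, 1 / 2, by norm_num, by norm_num⟩
  have hsm : ContDiff ℝ 2 β := β.contDiff
  have hdiff : Differentiable ℝ β := hsm.differentiable (by norm_num)
  have hd : ContDiff ℝ 1 (fderiv ℝ β) := hsm.fderiv_right (by norm_num)
  obtain ⟨K, hK⟩ := ContDiff.lipschitzWith_of_hasCompactSupport
    (β.hasCompactSupport.fderiv ℝ) hd (by norm_num)
  refine ⟨β, fun x => gradient β x, K + 1, by positivity, β.continuous, fun x => β.nonneg,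
    fun x => β.le_one, fun x hx => β.one_of_mem_closedBall (by simpa [β] using hx),
    fun x hx => β.zero_of_le_dist (by simpa [β] using hx),
    fun x => (hdiff x).hasGradientAt, fun x y => ?_⟩
  have h := Convex.norm_image_sub_le_of_norm_hasFDerivWithin_le' (f := β) (f' := fderiv ℝ β)
    (φ := fderiv ℝ β x) (s := Metric.closedBall x ‖y‖) (C := K * ‖y‖) (x := x) (y := x + y)
    (fun z _ => (hdiff z).hasFDerivAt.hasFDerivWithinAt)
    (fun z hz => ?_) (convex_closedBall x ‖y‖) (by simp) (by simp)
  · have hg : inner ℝ (gradient β x) y = fderiv ℝ β x y := by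
      rw [gradient, InnerProductSpace.toDual_symm_apply]
    rw [hg]
    rw [add_sub_cancel_left, Real.norm_eq_abs] at h
    nlinarith [sq_nonneg ‖y‖]
  · have := hK.dist_le_mul z x
    rw [dist_eq_norm] at this
    refine this.trans ?_
    gcongr
    simpa using hz

/-- A nonnegative function with second order Taylor constant `K` satisfies `|∇β|² ≤ 4 K β`. -/
theorem norm_gradient_sq_le {n : ℕ} {β : Euc n → ℝ} {x g : Euc n} {K : ℝ} (hK : 0 < K)
    (h0 : ∀ z, 0 ≤ β z) (h : ∀ y, |β (x + y) - β x - inner ℝ g y| ≤ K * ‖y‖ ^ 2) :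
    ‖g‖ ^ 2 ≤ 4 * K * β x := by
  -- The increment -g/(2K) minimises the upper bound β(x) + ⟨g, y⟩ + K|y|², whose minimum β(x) -
  -- |g|²/(4K) cannot be negative.
  have h1 := (abs_le.1 (h (-(1 / (2 * K)) • g))).2
  rw [inner_smul_right, real_inner_self_eq_norm_sq, norm_smul, Real.norm_eq_abs, abs_neg,
    abs_of_pos (by positivity), mul_pow] at h1
  have h2 := h0 (x + -(1 / (2 * K)) • g)
  have h3 : K * ((1 / (2 * K)) ^ 2 * ‖g‖ ^ 2) = ‖g‖ ^ 2 / (4 * K) := by field_simp; ring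
  have h4 : 1 / (2 * K) * ‖g‖ ^ 2 = 2 * (‖g‖ ^ 2 / (4 * K)) := by field_simp; ring
  have h5 : ‖g‖ ^ 2 / (4 * K) ≤ β x := by
    rw [h3] at h1
    linarith
  rw [div_le_iff₀ (by positivity)] at h5
  linarith

theorem integrableOn_div_kernel {n : ℕ} {p ε C : ℝ} (hp : (n : ℝ) < p) (hε : 0 < ε)
    {f : Euc n → ℝ} (hf : AEMeasurable f volume) {S : Set (Euc n)} (hSm : MeasurableSet S)
    (hS : ∀ y ∈ S, ε < ‖y‖) (hC : ∀ y ∈ S, |f y| ≤ C) :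
    IntegrableOn (fun y => f y / ‖y‖ ^ p) S := by
  refine (((integrableOn_kernel_tail hp hε).mono_set hS).const_mul C).mono' ?_ ?_
  · exact (hf.div (Measurable.aemeasurable (by fun_prop))).aestronglyMeasurable.restrict
  · refine (ae_restrict_iff' hSm).2 (Eventually.of_forall fun y hy => ?_)
    rw [norm_div, Real.norm_eq_abs, Real.norm_of_nonneg (by positivity : (0 : ℝ) ≤ ‖y‖ ^ p),
      mul_one_div]
    gcongr
    exact hC y hy

/-! ### The barrier inequality for the cutoff. -/

/-- Lower bound for the contribution of small jumps. -/
theorem near_integral_lower_bound {n : ℕ} (hn : 1 ≤ n) {s : ℝ} (hs0 : 0 < s) (hs1 : s < 1)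
    {β : Euc n → ℝ} {g x : Euc n} {K ε ρ : ℝ} (hβ : Continuous β) (h0 : ∀ z, 0 ≤ β z)
    (h1 : ∀ z, β z ≤ 1) (hK : 0 < K)
    (h : ∀ y, |β (x + y) - β x - inner ℝ g y| ≤ K * ‖y‖ ^ 2) (hε : 0 < ε) (hρ0 : 0 < ρ)
    (hρ : ρ < 1) :
    -(K * ρ ^ (1 - s) * ∫ y in Metric.ball (0 : Euc n) 1, ‖y‖ ^ (-((n : ℝ) - 1 + s))) ≤
      ∫ y in {y : Euc n | ε < ‖y‖} ∩ Metric.closedBall 0 ρ,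
        (β (x + y) - β x) / ‖y‖ ^ ((n : ℝ) + 2 * s) := by
  have hp : (n : ℝ) < n + 2 * s := by linarith
  set S : Set (Euc n) := {y : Euc n | ε < ‖y‖} ∩ Metric.closedBall 0 ρ with hSdef
  have hSm : MeasurableSet S := (measurableSet_lt_norm ε).inter Metric.isClosed_closedBall.measurableSet
  have hSe : ∀ y ∈ S, ε < ‖y‖ := fun y hy => hy.1
  have hSr : ∀ y ∈ S, ‖y‖ ≤ ρ := fun y hy => by simpa using hy.2
  have hSb : S ⊆ Metric.ball 0 1 := fun y hy => by
    simpa using (hSr y hy).trans_lt hρ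
  have hball := integrableOn_rpow_norm_ball hn (a := (n : ℝ) - 1 + s) (by linarith) 1
  have i1 : IntegrableOn (fun y => (β (x + y) - β x) / ‖y‖ ^ ((n : ℝ) + 2 * s)) S := by
    refine integrableOn_div_kernel (C := 1) hp hε ?_ hSm hSe fun y _ => ?_
    · exact Measurable.aemeasurable (by fun_prop)
    · rw [abs_le]; constructor <;> linarith [h0 (x + y), h1 (x + y), h0 x, h1 x]
  have i2 : IntegrableOn (fun y => inner ℝ g y / ‖y‖ ^ ((n : ℝ) + 2 * s)) S := by
    refine integrableOn_div_kernel (C := ‖g‖ * ρ) hp hε ?_ hSm hSe fun y hy => ?_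
    · exact Measurable.aemeasurable (by fun_prop)
    · refine (abs_real_inner_le_norm g y).trans ?_
      gcongr
      exact hSr y hy
  have i3 : IntegrableOn (fun y : Euc n => K * ρ ^ (1 - s) * ‖y‖ ^ (-((n : ℝ) - 1 + s))) S :=
    (hball.mono_set hSb).const_mul _
  have hodd : ∫ y in S, inner ℝ g y / ‖y‖ ^ ((n : ℝ) + 2 * s) = 0 :=
    setIntegral_eq_zero_of_odd hSm (fun y => by simp [hSdef]) fun y => by
      simp [neg_div]
  have hmono : ∫ y in S, (inner ℝ g y / ‖y‖ ^ ((n : ℝ) + 2 * s)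
      - K * ρ ^ (1 - s) * ‖y‖ ^ (-((n : ℝ) - 1 + s))) ≤
      ∫ y in S, (β (x + y) - β x) / ‖y‖ ^ ((n : ℝ) + 2 * s) := by
    refine setIntegral_mono_on (i2.sub i3) i1 hSm fun y hy => ?_
    have hy0 : 0 < ‖y‖ := hε.trans (hSe y hy)
    -- The remainder K|y|^(2-n-2s) is split so that |y|^(-(n-1+s)) is still integrable at the
    -- origin, and the spare factor |y|^(1-s) ≤ ρ^(1-s) supplies smallness.
    have e1 : ‖y‖ ^ (-((n : ℝ) - 1 + s)) * ‖y‖ ^ (1 - s) =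
        ‖y‖ ^ 2 / ‖y‖ ^ ((n : ℝ) + 2 * s) := by
      rw [← Real.rpow_natCast ‖y‖ 2, ← Real.rpow_add hy0, ← Real.rpow_sub hy0]
      congr 1
      push_cast
      ring
    have e2 : ‖y‖ ^ (1 - s) ≤ ρ ^ (1 - s) :=
      Real.rpow_le_rpow hy0.le (hSr y hy) (by linarith)
    have e3 : K * ‖y‖ ^ 2 / ‖y‖ ^ ((n : ℝ) + 2 * s) ≤
        K * ρ ^ (1 - s) * ‖y‖ ^ (-((n : ℝ) - 1 + s)) := by
      rw [mul_div_assoc, ← e1, mul_assoc, mul_comm (ρ ^ (1 - s))]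
      gcongr
    have e4 : (inner ℝ g y - K * ‖y‖ ^ 2) / ‖y‖ ^ ((n : ℝ) + 2 * s) ≤
        (β (x + y) - β x) / ‖y‖ ^ ((n : ℝ) + 2 * s) := by
      refine div_le_div_of_nonneg_right ?_ (by positivity)
      linarith [(abs_le.1 (h y)).1]
    rw [sub_div] at e4
    linarith
  rw [integral_sub i2 i3, hodd, integral_const_mul, zero_sub] at hmono
  refine le_trans (neg_le_neg ?_) hmono
  refine mul_le_mul_of_nonneg_left (setIntegral_mono_set hball
    (Eventually.of_forall fun y => by positivity) (LE.le.eventuallyLE hSb)) (by positivity)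

/-- Jumps from x into B_{1/4}, where β = 1, have length at most 1, hence kernel at least 1, and so
gain at least the volume of that ball. Discarding jumps shorter than ρ costs at most the volume of
B_{1/8}. The term -β(x) is integrated against the whole tail; it matters only where β(x) is not
small. -/
theorem far_integral_lower_bound {n : ℕ} {s : ℝ} (hs0 : 0 < s)
    {β : Euc n → ℝ} {x : Euc n} {ρ : ℝ} (hβ : Continuous β) (h0 : ∀ z, 0 ≤ β z)
    (h1 : ∀ z, β z ≤ 1) (h2 : ∀ z, ‖z‖ ≤ 1 / 4 → β z = 1) (hx : ‖x‖ ≤ 1 / 2)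
    (hρ0 : 0 < ρ) (hρ : ρ ≤ 1 / 8) :
    volume.real (Metric.closedBall (0 : Euc n) (1 / 4))
        - volume.real (Metric.closedBall (0 : Euc n) (1 / 8))
        - β x * ∫ y in {y : Euc n | ρ < ‖y‖}, 1 / ‖y‖ ^ ((n : ℝ) + 2 * s) ≤
      ∫ y in {y : Euc n | ρ < ‖y‖}, (β (x + y) - β x) / ‖y‖ ^ ((n : ℝ) + 2 * s) := by
  have hp : (n : ℝ) < n + 2 * s := by linarith
  have hSm := measurableSet_lt_norm (n := n) ρ
  set S : Set (Euc n) := {y : Euc n | ρ < ‖y‖} with hSdef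
  have hTm : MeasurableSet (Metric.closedBall (-x) (1 / 4)) :=
    Metric.isClosed_closedBall.measurableSet
  have i1 : IntegrableOn (fun y => (β (x + y) - β x) / ‖y‖ ^ ((n : ℝ) + 2 * s)) S := by
    refine integrableOn_div_kernel (C := 1) hp hρ0 ?_ hSm (fun _ h => h) fun y _ => ?_
    · exact Measurable.aemeasurable (by fun_prop)
    · rw [abs_le]; constructor <;> linarith [h0 (x + y), h1 (x + y), h0 x, h1 x]
  have i2 : IntegrableOn ((Metric.closedBall (-x) (1 / 4)).indicator fun _ : Euc n => (1 : ℝ)) S := by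
    refine Integrable.integrableOn ((integrable_indicator_iff hTm).2 ?_)
    exact integrableOn_const (measure_closedBall_lt_top.ne)
  have i3 : IntegrableOn (fun y : Euc n => β x * (1 / ‖y‖ ^ ((n : ℝ) + 2 * s))) S :=
    (integrableOn_kernel_tail hp hρ0).const_mul _
  have hmono : ∫ y in S, ((Metric.closedBall (-x) (1 / 4)).indicator (fun _ => (1 : ℝ)) y
      - β x * (1 / ‖y‖ ^ ((n : ℝ) + 2 * s))) ≤
      ∫ y in S, (β (x + y) - β x) / ‖y‖ ^ ((n : ℝ) + 2 * s) := by
    refine setIntegral_mono_on (i2.sub i3) i1 hSm fun y hy => ?_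
    have hy0 : 0 < ‖y‖ := hρ0.trans hy
    rw [sub_div, mul_one_div]
    gcongr
    by_cases hyT : y ∈ Metric.closedBall (-x) (1 / 4)
    · have hxy : ‖x + y‖ ≤ 1 / 4 := by
        rw [mem_closedBall_iff_norm, sub_neg_eq_add, add_comm] at hyT
        exact hyT
      have hy1 : ‖y‖ ≤ 1 := by
        have := norm_sub_le (x + y) x
        rw [add_sub_cancel_left] at this
        linarith
      rw [indicator_of_mem hyT, h2 _ hxy, le_div_iff₀ (by positivity), one_mul]
      exact Real.rpow_le_one hy0.le hy1 (by positivity)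
    · rw [indicator_of_notMem hyT]
      have := h0 (x + y)
      positivity
  rw [integral_sub i2 i3, integral_const_mul, integral_indicator hTm, setIntegral_const,
    smul_eq_mul, mul_one, measureReal_restrict_apply hTm] at hmono
  have hcover : Metric.closedBall (-x) (1 / 4) ⊆
      (Metric.closedBall (-x) (1 / 4) ∩ S) ∪ Metric.closedBall 0 (1 / 8) := fun y hy => by
    by_cases hyS : ρ < ‖y‖
    · exact Or.inl ⟨hy, hyS⟩
    · exact Or.inr (by simpa using (not_lt.1 hyS).trans hρ)
  have hm : volume.real (Metric.closedBall (-x) (1 / 4)) ≤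
      volume.real (Metric.closedBall (-x) (1 / 4) ∩ S)
        + volume.real (Metric.closedBall (0 : Euc n) (1 / 8)) :=
    (measureReal_mono hcover (measure_union_lt_top
      ((measure_mono inter_subset_left).trans_lt measure_closedBall_lt_top)
      measure_closedBall_lt_top).ne).trans (measureReal_union_le _ _)
  rw [show volume.real (Metric.closedBall (-x) (1 / 4)) =
    volume.real (Metric.closedBall (0 : Euc n) (1 / 4)) from by
      simp [measureReal_def, Measure.addHaar_closedBall_center]] at hm
  linarith

/-- At points where the cutoff `β` is small, its fractional Laplacian is strictly negative and
dominates any multiple of the gradient. -/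
theorem cutoff_barrier {n : ℕ} (hn : 1 ≤ n) {s : ℝ} (hs0 : 0 < s) (hs1 : s < 1)
    {β : Euc n → ℝ} {G : Euc n → Euc n} {K : ℝ} (hK : 0 < K) (hβ : Continuous β)
    (h0 : ∀ z, 0 ≤ β z) (h1 : ∀ z, β z ≤ 1) (h2 : ∀ z, ‖z‖ ≤ 1 / 4 → β z = 1)
    (h : ∀ x y, |β (x + y) - β x - inner ℝ (G x) y| ≤ K * ‖y‖ ^ 2) (A : ℝ) :
    ∃ C₁ η ρ : ℝ, 0 ≤ C₁ ∧ 0 < η ∧ 0 < ρ ∧ ρ ≤ 1 / 8 ∧ ∀ x : Euc n, ‖x‖ ≤ 1 / 2 → ∀ ε, 0 < ε → ε < ρ →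
      A * ‖G x‖ + η ≤ C₁ * β x + fracLaplacianConst n s *
        ∫ y in {y : Euc n | ε < ‖y‖}, (β (x + y) - β x) / ‖y‖ ^ ((n : ℝ) + 2 * s) := by
  have hp : (n : ℝ) < n + 2 * s := by linarith
  set c := fracLaplacianConst n s with hc
  have hc0 : 0 < c := fracLaplacianConst_pos n hs0 hs1
  set J := ∫ y in Metric.ball (0 : Euc n) 1, ‖y‖ ^ (-((n : ℝ) - 1 + s)) with hJ
  set w := volume.real (Metric.closedBall (0 : Euc n) (1 / 4))
        - volume.real (Metric.closedBall (0 : Euc n) (1 / 8)) with hw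
  have hw0 : 0 < w := by
    have hb : 0 < volume.real (Metric.closedBall (0 : Euc n) 1) :=
      ENNReal.toReal_pos (Metric.measure_closedBall_pos _ _ one_pos).ne'
        measure_closedBall_lt_top.ne
    have hfr : Module.finrank ℝ (Euc n) = n := by simp
    rw [hw, Measure.addHaar_real_closedBall' _ _ (by norm_num : (0 : ℝ) ≤ 1 / 4),
      Measure.addHaar_real_closedBall' _ _ (by norm_num : (0 : ℝ) ≤ 1 / 8), ← sub_mul, hfr]
    refine mul_pos (sub_pos.2 ?_) hb
    exact pow_lt_pow_left₀ (by norm_num) (by norm_num) (by omega)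
  obtain ⟨ρ, hρ0, hρ1, hρ⟩ : ∃ ρ : ℝ, 0 < ρ ∧ ρ ≤ 1 / 8 ∧ K * ρ ^ (1 - s) * J ≤ w / 2 := by
    have ht : Tendsto (fun ρ : ℝ => K * ρ ^ (1 - s) * J) (𝓝[>] 0) (𝓝 (K * 0 ^ (1 - s) * J)) := by
      refine ((Tendsto.const_mul K ?_).mul_const J)
      exact ((Real.continuousAt_rpow_const 0 (1 - s) (Or.inr (by linarith))).tendsto).mono_left
        nhdsWithin_le_nhds
    rw [Real.zero_rpow (by linarith), mul_zero, zero_mul] at ht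
    have e1 := ht.eventually (eventually_le_nhds (by positivity : (0 : ℝ) < w / 2))
    have e2 : ∀ᶠ ρ : ℝ in 𝓝[>] 0, ρ ∈ Ioo (0 : ℝ) (1 / 8) := Ioo_mem_nhdsGT (by norm_num)
    obtain ⟨ρ, h3, h4⟩ := (e1.and e2).exists
    exact ⟨ρ, h4.1, h4.2.le, h3⟩
  set W := ∫ y in {y : Euc n | ρ < ‖y‖}, 1 / ‖y‖ ^ ((n : ℝ) + 2 * s) with hW
  have hW0 : 0 ≤ W := integral_nonneg fun y => by positivity
  -- The near and far bounds leave cw/2 - cWβ(x). Half of cw/2 becomes η; the other half absorbs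
  -- A|∇β| through Young's inequality and |∇β|² ≤ 4Kβ, which produces the second term of C₁.
  refine ⟨c * W + 4 * A ^ 2 * K / (c * w), c * w / 4, ρ, by positivity, by positivity, hρ0, hρ1,
    fun x hx ε hε hερ => ?_⟩
  have hnear := near_integral_lower_bound hn hs0 hs1 hβ h0 h1 hK (h x) hε hρ0 (by linarith)
  have hfar := far_integral_lower_bound hs0 hβ h0 h1 h2 hx hρ0 hρ1
  rw [← hW, ← hw] at hfar
  rw [← hJ] at hnear
  have hG := norm_gradient_sq_le hK h0 (h x)
  have hsplit : ∫ y in {y : Euc n | ε < ‖y‖}, (β (x + y) - β x) / ‖y‖ ^ ((n : ℝ) + 2 * s) =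
      (∫ y in {y : Euc n | ε < ‖y‖} ∩ Metric.closedBall 0 ρ,
        (β (x + y) - β x) / ‖y‖ ^ ((n : ℝ) + 2 * s)) +
      ∫ y in {y : Euc n | ρ < ‖y‖}, (β (x + y) - β x) / ‖y‖ ^ ((n : ℝ) + 2 * s) := by
    have hu : {y : Euc n | ε < ‖y‖} =
        ({y : Euc n | ε < ‖y‖} ∩ Metric.closedBall 0 ρ) ∪ {y : Euc n | ρ < ‖y‖} := by
      ext y
      simp only [mem_union, mem_inter_iff, mem_ofPred_eq, mem_closedBall_zero_iff]
      constructor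
      · intro hy
        rcases le_or_gt ‖y‖ ρ with h' | h'
        · exact Or.inl ⟨hy, h'⟩
        · exact Or.inr h'
      · rintro (h' | h')
        · exact h'.1
        · exact hερ.trans h'
    have hi : ∀ r > 0, IntegrableOn (fun y => (β (x + y) - β x) / ‖y‖ ^ ((n : ℝ) + 2 * s))
        {y : Euc n | r < ‖y‖} := fun r hr => by
      refine integrableOn_div_kernel (C := 1) hp hr ?_ (measurableSet_lt_norm r) (fun _ h => h)
        fun y _ => ?_
      · exact Measurable.aemeasurable (by fun_prop)
      · rw [abs_le]; constructor <;> linarith [h0 (x + y), h1 (x + y), h0 x, h1 x]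
    conv_lhs => rw [hu]
    refine setIntegral_union ?_ (measurableSet_lt_norm ρ)
      ((hi ε hε).mono_set inter_subset_left) (hi ρ hρ0)
    rw [Set.disjoint_left]
    intro y hy hy'
    have h3 : ‖y‖ ≤ ρ := by simpa using hy.2
    exact absurd hy' (not_lt.2 h3)
  rw [hsplit]
  have hAG : A * ‖G x‖ ≤ c * w / 4 + 4 * A ^ 2 * K / (c * w) * β x := by
    have h3 : A ^ 2 * ‖G x‖ ^ 2 ≤ A ^ 2 * (4 * K * β x) := by gcongr
    have h4 : A * ‖G x‖ ≤ c * w / 4 + (A * ‖G x‖) ^ 2 / (c * w) := by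
      have h5 : (0 : ℝ) < c * w := by positivity
      rw [← sub_le_iff_le_add', le_div_iff₀ h5]
      nlinarith [sq_nonneg (A * ‖G x‖ - c * w / 2)]
    have h6 : (A * ‖G x‖) ^ 2 / (c * w) ≤ A ^ 2 * (4 * K * β x) / (c * w) := by
      rw [mul_pow]
      gcongr
    have h7 : A ^ 2 * (4 * K * β x) / (c * w) = 4 * A ^ 2 * K / (c * w) * β x := by ring
    linarith
  have hfin : c * (w / 2 - β x * W) ≤ c * ((∫ y in {y : Euc n | ε < ‖y‖} ∩ Metric.closedBall 0 ρ,
        (β (x + y) - β x) / ‖y‖ ^ ((n : ℝ) + 2 * s)) +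
      ∫ y in {y : Euc n | ρ < ‖y‖}, (β (x + y) - β x) / ‖y‖ ^ ((n : ℝ) + 2 * s)) := by
    gcongr
    linarith
  nlinarith

/-! ### The fractional Laplacian at a maximum point. -/

theorem aemeasurable_comp_add_left {n : ℕ} {w : Euc n → ℝ} (hw : AEMeasurable w volume)
    (x : Euc n) : AEMeasurable (fun y => w (x + y)) volume :=
  hw.comp_quasiMeasurePreserving (measurePreserving_add_left volume x).quasiMeasurePreserving

theorem setIntegral_closedBall_comp_add_left {n : ℕ} (f : Euc n → ℝ) (x : Euc n) (r : ℝ) :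
    ∫ y in Metric.closedBall (-x) r, f (x + y) = ∫ z in Metric.closedBall 0 r, f z := by
  have h := (measurePreserving_add_left (volume : Measure (Euc n)) x).setIntegral_preimage_emb
    (measurableEmbedding_addLeft x) f (Metric.closedBall 0 r)
  rw [← h]
  congr 2
  ext y
  simp [dist_eq_norm, add_comm]

/-- If `w + m β` has a maximum at `x` in the unit ball, then `(-Δ)^s w (x)` is bounded below by the
fractional Laplacian of the barrier, improved by the average of `1 - w` on a ball. -/
theorem fracLaplacian_lower_bound {n : ℕ} (hn : 1 ≤ n) {s : ℝ} (hs0 : 0 < s) (hs1 : s < 1)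
    {β : Euc n → ℝ} (hβ : Continuous β) (h0 : ∀ z, 0 ≤ β z)
    (h1 : ∀ z, β z ≤ 1) (h2 : ∀ z, ‖z‖ ≤ 1 / 4 → β z = 1) (h3 : ∀ z, 1 / 2 ≤ ‖z‖ → β z = 0)
    {w : Euc n → ℝ} {x : Euc n} {m κ η ρ D L C : ℝ} (hx : ‖x‖ ≤ 1 / 2) (hm : 0 ≤ m)
    (hκ : 0 ≤ κ) (hη0 : 0 ≤ η) (hη1 : η ≤ 1) (hρ : 0 < ρ)
    (hw : AEMeasurable w volume) (hC : ∀ z, |w z| ≤ C)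
    (hmax : ∀ z, ‖z‖ < 1 → w z + m * β z ≤ w x + m * β x)
    (hone : 1 ≤ w x + m * β x) (hlow : ∀ z, ‖z‖ < 1 → -1 ≤ w z)
    (hout : ∀ z, 1 ≤ ‖z‖ → w z ≤ 1 + κ * ‖z‖ ^ s)
    (hD : ∀ ε, 0 < ε → ε < ρ → D ≤ fracLaplacianConst n s *
      ∫ y in {y : Euc n | ε < ‖y‖}, (β (x + y) - β x) / ‖y‖ ^ ((n : ℝ) + 2 * s))
    (hL : HasFracLaplacianAt s w x L) :
    fracLaplacianConst n s * η * ((∫ z in Metric.closedBall (0 : Euc n) (1 / 4), (1 - w z))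
        - m * volume.real (Metric.closedBall (0 : Euc n) (1 / 4))) + m * D
      - fracLaplacianConst n s * κ *
        (2 ^ s * ∫ y in {y : Euc n | 1 / 4 < ‖y‖}, 1 / ‖y‖ ^ ((n : ℝ) + s)) ≤ L := by
  have hp : (n : ℝ) < n + 2 * s := by linarith
  set c := fracLaplacianConst n s with hc
  have hc0 : 0 < c := fracLaplacianConst_pos n hs0 hs1
  set V := volume.real (Metric.closedBall (0 : Euc n) 1) with hV
  set R : Set (Euc n) := {y : Euc n | 1 / 4 < ‖y‖} with hR
  have hRm : MeasurableSet R := measurableSet_lt_norm _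
  set T : Set (Euc n) := Metric.closedBall (-x) (1 / 4) with hT
  have hTm : MeasurableSet T := Metric.isClosed_closedBall.measurableSet
  have hTfin : volume T < ⊤ := measure_closedBall_lt_top
  set T₀ := 2 ^ s * ∫ y in R, 1 / ‖y‖ ^ ((n : ℝ) + s) with hT₀
  set Q := (∫ z in Metric.closedBall (0 : Euc n) (1 / 4), (1 - w z))
        - m * volume.real (Metric.closedBall (0 : Euc n) (1 / 4)) with hQ
  have hwx := aemeasurable_comp_add_left hw x
  have iX : IntegrableOn (fun y => 1 - w (x + y) - m) T := by
    refine Measure.integrableOn_of_bounded (M := 1 + C + m) hTfin.ne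
      (((aemeasurable_const.sub hwx).sub aemeasurable_const).aestronglyMeasurable)
      (Eventually.of_forall fun y => ?_)
    rw [Real.norm_eq_abs, abs_le]
    have := abs_le.1 (hC (x + y))
    constructor <;> linarith
  have hTQ : ∫ y in T, (1 - w (x + y) - m) = Q := by
    have i1 : IntegrableOn (fun z => 1 - w z) (Metric.closedBall (0 : Euc n) (1 / 4)) := by
      refine Measure.integrableOn_of_bounded (M := 1 + C) measure_closedBall_lt_top.ne
        ((aemeasurable_const.sub hw).aestronglyMeasurable) (Eventually.of_forall fun y => ?_)
      rw [Real.norm_eq_abs, abs_le]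
      have := abs_le.1 (hC y)
      constructor <;> linarith
    rw [hT, setIntegral_closedBall_comp_add_left (fun z => 1 - w z - m),
      integral_sub i1 (integrableOn_const measure_closedBall_lt_top.ne), setIntegral_const,
      smul_eq_mul, mul_comm]
  have hTx : ∀ y ∈ T, ‖x + y‖ ≤ 1 / 4 := fun y hy => by
    rw [hT, mem_closedBall_iff_norm, sub_neg_eq_add, add_comm] at hy
    exact hy
  -- the inequality for the truncated integrals
  have key : ∀ ε, 0 < ε → ε < ρ → c * η * (Q - 2 * (ε ^ n * V)) + m * D - c * κ * T₀ ≤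
      c * ∫ y in {y : Euc n | ε < ‖y‖}, (w x - w (x + y)) / ‖y‖ ^ ((n : ℝ) + 2 * s) := by
    intro ε hε hερ
    have hSm := measurableSet_lt_norm (n := n) ε
    set S : Set (Euc n) := {y : Euc n | ε < ‖y‖} with hS
    have i0 : IntegrableOn (fun y => (w x - w (x + y)) / ‖y‖ ^ ((n : ℝ) + 2 * s)) S := by
      refine integrableOn_div_kernel (f := fun y => w x - w (x + y)) (C := 2 * C) hp hε
        (aemeasurable_const.sub hwx) hSm
        (fun _ h => h) fun y _ => ?_
      have := abs_le.1 (hC (x + y))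
      have := abs_le.1 (hC x)
      rw [abs_le]
      constructor <;> linarith
    have i1 : IntegrableOn (fun y => m * ((β (x + y) - β x) / ‖y‖ ^ ((n : ℝ) + 2 * s))) S := by
      refine Integrable.const_mul (integrableOn_div_kernel (C := 1) hp hε ?_ hSm
        (fun _ h => h) fun y _ => ?_) m
      · exact Measurable.aemeasurable (by fun_prop)
      · rw [abs_le]; constructor <;> linarith [h0 (x + y), h1 (x + y), h0 x, h1 x]
    have i2 : IntegrableOn (fun y => η * T.indicator (fun y => 1 - w (x + y) - m) y) S :=
      (((integrable_indicator_iff hTm).2 iX).const_mul η).integrableOn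
    have i3' : IntegrableOn (fun y : Euc n => 1 / ‖y‖ ^ ((n : ℝ) + s)) R :=
      integrableOn_kernel_tail (by linarith) (by norm_num)
    have i3 : IntegrableOn (fun y => κ * (2 ^ s *
        R.indicator (fun y : Euc n => 1 / ‖y‖ ^ ((n : ℝ) + s)) y)) S :=
      ((((integrable_indicator_iff hRm).2 i3').const_mul (2 ^ s)).const_mul κ).integrableOn
    have i12 : IntegrableOn (fun y => m * ((β (x + y) - β x) / ‖y‖ ^ ((n : ℝ) + 2 * s))
        + η * T.indicator (fun y => 1 - w (x + y) - m) y) S := i1.add i2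
    have hmono : ∫ y in S, (m * ((β (x + y) - β x) / ‖y‖ ^ ((n : ℝ) + 2 * s))
        + η * T.indicator (fun y => 1 - w (x + y) - m) y
        - κ * (2 ^ s * R.indicator (fun y : Euc n => 1 / ‖y‖ ^ ((n : ℝ) + s)) y)) ≤
        ∫ y in S, (w x - w (x + y)) / ‖y‖ ^ ((n : ℝ) + 2 * s) := by
      refine setIntegral_mono_on (i12.sub i3) i0 hSm fun y hy => ?_
      have hy0 : 0 < ‖y‖ := hε.trans hy
      have hk : 0 < ‖y‖ ^ ((n : ℝ) + 2 * s) := by positivity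
      have hRnn : 0 ≤ κ * (2 ^ s * R.indicator (fun y : Euc n => 1 / ‖y‖ ^ ((n : ℝ) + s)) y) :=
        mul_nonneg hκ (mul_nonneg (by positivity) (indicator_nonneg (fun y _ => by positivity) y))
      -- Jumps leaving the unit ball have |y| ≥ 1/2 and |x + y| ≤ 2|y|, so the growth bound costs an
      -- integrable tail. For jumps inside, the difference of w is that of mβ plus a term that
      -- maximality makes nonnegative; on T, where β = 1, a fraction η of 1 - w - m is kept from it.
      rcases le_or_gt 1 ‖x + y‖ with hz | hz
      · have hyT : y ∉ T := fun h => by linarith [hTx y h]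
        have hyn : ‖x + y‖ ≤ ‖x‖ + ‖y‖ := norm_add_le x y
        have hyR : y ∈ R := by
          change 1 / 4 < ‖y‖
          linarith
        have e1 : ‖x + y‖ ^ s ≤ 2 ^ s * ‖y‖ ^ s := by
          rw [← Real.mul_rpow (by norm_num) hy0.le]
          exact Real.rpow_le_rpow (norm_nonneg _) (by linarith) hs0.le
        have e2 : 1 / ‖y‖ ^ ((n : ℝ) + s) = ‖y‖ ^ s / ‖y‖ ^ ((n : ℝ) + 2 * s) := by
          rw [eq_div_iff hk.ne', one_div_mul_eq_div, ← Real.rpow_sub hy0]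
          congr 1
          ring
        rw [indicator_of_notMem hyT, indicator_of_mem hyR, e2, h3 (x + y) (by linarith), mul_zero,
          add_zero, ← mul_div_assoc, ← mul_div_assoc, ← mul_div_assoc, ← sub_div]
        refine div_le_div_of_nonneg_right ?_ hk.le
        have e3 := hout _ hz
        have e4 : κ * ‖x + y‖ ^ s ≤ κ * (2 ^ s * ‖y‖ ^ s) := by gcongr
        linarith
      · have hq := hmax _ hz
        have hsplit : (w x - w (x + y)) / ‖y‖ ^ ((n : ℝ) + 2 * s) =
            m * ((β (x + y) - β x) / ‖y‖ ^ ((n : ℝ) + 2 * s)) +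
            (w x + m * β x - (w (x + y) + m * β (x + y))) / ‖y‖ ^ ((n : ℝ) + 2 * s) := by
          ring
        have hq0 : 0 ≤ (w x + m * β x - (w (x + y) + m * β (x + y))) /
            ‖y‖ ^ ((n : ℝ) + 2 * s) := div_nonneg (by linarith) hk.le
        rw [hsplit]
        by_cases hyT : y ∈ T
        · rw [indicator_of_mem hyT]
          have hzb := hTx y hyT
          have hy1 : ‖y‖ ≤ 1 := by
            have := norm_sub_le (x + y) x
            rw [add_sub_cancel_left] at this
            linarith
          have hk1 : ‖y‖ ^ ((n : ℝ) + 2 * s) ≤ 1 := Real.rpow_le_one hy0.le hy1 (by positivity)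
          have e1 : w x + m * β x - (w (x + y) + m * β (x + y)) ≤
              (w x + m * β x - (w (x + y) + m * β (x + y))) / ‖y‖ ^ ((n : ℝ) + 2 * s) := by
            rw [le_div_iff₀ hk]
            exact mul_le_of_le_one_right (by linarith) hk1
          have e2 : η * (1 - w (x + y) - m) ≤ w x + m * β x - (w (x + y) + m * β (x + y)) := by
            rcases le_or_gt 0 (1 - w (x + y) - m) with hX | hX
            · refine (mul_le_of_le_one_left hX hη1).trans ?_
              rw [h2 _ hzb]
              linarith
            · exact (mul_nonpos_of_nonneg_of_nonpos hη0 hX.le).trans (by linarith)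
          linarith
        · rw [indicator_of_notMem hyT, mul_zero, add_zero]
          linarith
    rw [integral_sub i12 i3, integral_add i1 i2, integral_const_mul, integral_const_mul,
      integral_const_mul, integral_const_mul, integral_indicator hTm, integral_indicator hRm,
      Measure.restrict_restrict hTm, Measure.restrict_restrict hRm] at hmono
    -- The truncation removes from T only points of the ε-ball, where the integrand is at most 2;
    -- this error vanishes as ε → 0.
    have hTS : Q - 2 * (ε ^ n * V) ≤ ∫ y in T ∩ S, (1 - w (x + y) - m) := by
      have e1 := integral_inter_add_sdiff (s := T) (t := S) hSm iX
      have hTSm : MeasurableSet (T \ S) := hTm.diff hSm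
      have hfin : volume (T \ S) ≠ ⊤ := ((measure_mono sdiff_subset).trans_lt hTfin).ne
      have e2 : ∫ y in T \ S, (1 - w (x + y) - m) ≤ ∫ y in T \ S, (2 : ℝ) := by
        refine setIntegral_mono_on (iX.mono_set sdiff_subset)
          (integrableOn_const hfin) hTSm fun y hy => ?_
        have := hlow (x + y) (by linarith [hTx y hy.1])
        linarith
      have e3 : volume.real (T \ S) ≤ ε ^ n * V := by
        have : volume.real (Metric.closedBall (0 : Euc n) ε) = ε ^ n * V := by
          rw [Measure.addHaar_real_closedBall' _ _ hε.le, finrank_euclideanSpace_fin]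
        rw [← this]
        refine measureReal_mono (fun y hy => ?_) measure_closedBall_lt_top.ne
        simpa [hS] using hy.2
      rw [setIntegral_const, smul_eq_mul] at e2
      linarith
    have hRS : ∫ y in R ∩ S, 1 / ‖y‖ ^ ((n : ℝ) + s) ≤ ∫ y in R, 1 / ‖y‖ ^ ((n : ℝ) + s) :=
      setIntegral_mono_set i3' (Eventually.of_forall fun y => by positivity)
        (LE.le.eventuallyLE inter_subset_left)
    have f1 : c * η * (Q - 2 * (ε ^ n * V)) ≤ c * η * ∫ y in T ∩ S, (1 - w (x + y) - m) := by
      gcongr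
    have f2 : m * D ≤ m * (c * ∫ y in S, (β (x + y) - β x) / ‖y‖ ^ ((n : ℝ) + 2 * s)) :=
      mul_le_mul_of_nonneg_left (hD ε hε hερ) hm
    have f3 : c * κ * (2 ^ s * ∫ y in R ∩ S, 1 / ‖y‖ ^ ((n : ℝ) + s)) ≤ c * κ * T₀ := by
      rw [hT₀]
      gcongr
    have f4 := mul_le_mul_of_nonneg_left hmono hc0.le
    linarith
  have hlim : Tendsto (fun ε : ℝ => c * η * (Q - 2 * (ε ^ n * V)) + m * D - c * κ * T₀) (𝓝[>] 0)
      (𝓝 (c * η * Q + m * D - c * κ * T₀)) := by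
    have hcont : Continuous fun ε : ℝ => c * η * (Q - 2 * (ε ^ n * V)) + m * D - c * κ * T₀ := by
      fun_prop
    have := (hcont.tendsto 0).mono_left (nhdsWithin_le_nhds (s := Ioi 0))
    rwa [zero_pow (by omega), zero_mul, mul_zero, sub_zero] at this
  refine le_of_tendsto_of_tendsto hlim hL ?_
  filter_upwards [Ioo_mem_nhdsGT hρ] with ε hε
  exact key ε hε.1 hε.2

/-! ### Improvement of oscillation at unit scale. -/

/-- Solutions at unit scale of `|v_t + (-Δ)^s v| ≤ A |∇v| + ε₀` in the unit cylinder, bounded by one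
there and with a controlled growth outside. -/
structure UnitSolution {n : ℕ} (s A ε₀ κ : ℝ) (v : Euc n → ℝ → ℝ) : Prop where
  aemeasurable : ∀ t ∈ Icc (-1 : ℝ) 0, AEMeasurable (fun x => v x t) volume
  bounded : ∃ C, ∀ x, ∀ t ∈ Icc (-1 : ℝ) 0, |v x t| ≤ C
  continuousOn : ContinuousOn (fun p : Euc n × ℝ => v p.1 p.2) (Metric.ball 0 1 ×ˢ Icc (-1) 0)
  abs_le_one : ∀ x, ‖x‖ < 1 → ∀ t ∈ Icc (-1 : ℝ) 0, |v x t| ≤ 1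
  abs_le_growth : ∀ x, 1 ≤ ‖x‖ → ∀ t ∈ Icc (-1 : ℝ) 0, |v x t| ≤ 1 + κ * ‖x‖ ^ s
  equation : ∀ x, ‖x‖ < 1 → ∀ t ∈ Icc (-1 : ℝ) 0, ∃ (τ L : ℝ) (p : Euc n),
    HasDerivWithinAt (v x) τ (Icc (-1) 0) t ∧ HasGradientAt (fun y => v y t) p x ∧
    HasFracLaplacianAt s (fun y => v y t) x L ∧ |τ + L| ≤ A * ‖p‖ + ε₀

theorem HasFracLaplacianAt.neg {n : ℕ} {s L : ℝ} {w : Euc n → ℝ} {x : Euc n}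
    (h : HasFracLaplacianAt s w x L) : HasFracLaplacianAt s (fun y => -w y) x (-L) := by
  unfold HasFracLaplacianAt at h ⊢
  refine (Tendsto.neg h).congr fun ε => ?_
  rw [← mul_neg, ← integral_neg]
  congr 2
  ext y
  ring

theorem UnitSolution.neg {n : ℕ} {s A ε₀ κ : ℝ} {v : Euc n → ℝ → ℝ}
    (h : UnitSolution s A ε₀ κ v) : UnitSolution s A ε₀ κ (fun x t => -v x t) where
  aemeasurable t ht := (h.aemeasurable t ht).neg
  bounded := by simpa using h.bounded
  continuousOn := h.continuousOn.neg
  abs_le_one := by simpa using h.abs_le_one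
  abs_le_growth := by simpa using h.abs_le_growth
  equation x hx t ht := by
    obtain ⟨τ, L, p, h1, h2, h3, h4⟩ := h.equation x hx t ht
    refine ⟨-τ, -L, -p, h1.neg, ?_, h3.neg, ?_⟩
    · rw [hasGradientAt_iff_hasFDerivAt] at h2 ⊢
      rw [map_neg]
      exact h2.neg
    · rw [← neg_add, abs_neg, norm_neg]
      exact h4

/-- The left derivative at a maximum over the past is nonnegative. -/
theorem nonneg_of_hasDerivWithinAt_of_max {f : ℝ → ℝ} {f' a b t : ℝ} (hat : a < t) (htb : t ≤ b)
    (hf : HasDerivWithinAt f f' (Icc a b) t) (hmax : ∀ r ∈ Icc a b, f r ≤ f t) : 0 ≤ f' := by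
  have hloc : IsLocalMaxOn f (Icc a b) t := by
    filter_upwards [self_mem_nhdsWithin] with r hr using hmax r hr
  have hseg : segment ℝ t a ⊆ Icc a b := by
    rw [segment_symm, segment_eq_Icc hat.le]
    exact Icc_subset_Icc_right htb
  have := hloc.hasFDerivWithinAt_nonpos hf.hasFDerivWithinAt
    (sub_mem_posTangentConeAt_of_segment_subset hseg)
  have h2 : (a - t) * f' ≤ 0 := by simpa using this
  nlinarith

theorem UnitSolution.average_continuousOn {n : ℕ} {s A ε₀ κ : ℝ} {v : Euc n → ℝ → ℝ}
    (h : UnitSolution s A ε₀ κ v) :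
    ContinuousOn (fun t => ∫ z in Metric.closedBall (0 : Euc n) (1 / 4), (1 - v z t))
      (Icc (-1) 0) := by
  obtain ⟨C, hC⟩ := h.bounded
  refine continuousOn_of_dominated (bound := fun _ => 1 + C)
    (fun t ht => (aemeasurable_const.sub (h.aemeasurable t ht)).aestronglyMeasurable.restrict)
    (fun t ht => Eventually.of_forall fun z => ?_)
    (integrableOn_const measure_closedBall_lt_top.ne) ?_
  · rw [Real.norm_eq_abs, abs_le]
    have := abs_le.1 (hC z t ht)
    constructor <;> linarith
  · refine (ae_restrict_iff' Metric.isClosed_closedBall.measurableSet).2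
      (Eventually.of_forall fun z hz => continuousOn_const.sub ?_)
    refine h.continuousOn.comp (f := fun t => (z, t)) (by fun_prop) fun t ht => ⟨?_, ht⟩
    rw [mem_ball_zero_iff]
    rw [mem_closedBall_zero_iff] at hz
    linarith

/-- The weight is the Duhamel-like expression m(t) = c e^{-C₁(t+1)} ∫_{-1}^t g, a subsolution of m'
= cg - C₁m on [-1, 0]. The mass collected before time -1/2 survives later up to the factor e^{-C₁}.
Extending g by clamping time to [-1, 0] makes m differentiable on the whole line. -/
theorem exists_weight {g : ℝ → ℝ} (hg : ContinuousOn g (Icc (-1) 0))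
    (hg0 : ∀ t ∈ Icc (-1 : ℝ) 0, 0 ≤ g t) {c C₁ w : ℝ} (hc : 0 ≤ c) (hC₁ : 0 ≤ C₁)
    (hw : w ≤ ∫ t in (-1 : ℝ)..(-1 / 2), g t) :
    ∃ m m' : ℝ → ℝ, (∀ t, HasDerivAt m (m' t) t) ∧ m (-1) = 0 ∧
      (∀ t ∈ Icc (-1 : ℝ) 0, 0 ≤ m t) ∧ (∀ t ∈ Icc (-1 : ℝ) 0, m' t ≤ c * g t - C₁ * m t) ∧
      ∀ t ∈ Icc (-1 / 2 : ℝ) 0, c * Real.exp (-C₁) * w ≤ m t := by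
  set π : ℝ → ℝ := fun t => max (-1) (min t 0) with hπ
  have hπmem : ∀ t, π t ∈ Icc (-1 : ℝ) 0 := fun t => by
    simp only [hπ, mem_Icc]
    exact ⟨le_max_left _ _, max_le (by norm_num) (min_le_right _ _)⟩
  have hπeq : ∀ t ∈ Icc (-1 : ℝ) 0, π t = t := fun t ht => by
    simp only [hπ]
    rw [min_eq_left ht.2, max_eq_right ht.1]
  have hgc : Continuous fun t => g (π t) := hg.comp_continuous (by fun_prop) hπmem
  set H : ℝ → ℝ := fun t => ∫ r in (-1 : ℝ)..t, g (π r) with hH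
  have hHd : ∀ t, HasDerivAt H (g (π t)) t := fun t =>
    intervalIntegral.integral_hasDerivAt_right (hgc.intervalIntegrable _ _)
      (hgc.stronglyMeasurableAtFilter _ _) hgc.continuousAt
  have hHmono : Monotone H := monotone_of_deriv_nonneg (fun t => (hHd t).differentiableAt)
    fun t => by rw [(hHd t).deriv]; exact hg0 _ (hπmem t)
  have hH0 : H (-1) = 0 := by simp [hH]
  have hHnn : ∀ t, -1 ≤ t → 0 ≤ H t := fun t ht => hH0 ▸ hHmono ht
  have hHw : w ≤ H (-1 / 2) := by
    refine hw.trans_eq (intervalIntegral.integral_congr fun t ht => ?_)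
    rw [uIcc_of_le (by norm_num)] at ht
    rw [hπeq t ⟨ht.1, by linarith [ht.2]⟩]
  refine ⟨fun t => c * Real.exp (-C₁ * (t + 1)) * H t,
    fun t => c * (Real.exp (-C₁ * (t + 1)) * (-C₁)) * H t
      + c * Real.exp (-C₁ * (t + 1)) * g (π t), fun t => ?_, by simp [hH0],
    fun t ht => mul_nonneg (by positivity) (hHnn t ht.1), fun t ht => ?_, fun t ht => ?_⟩
  · have h1 : HasDerivAt (fun t => -C₁ * (t + 1)) (-C₁) t := by
      simpa using ((hasDerivAt_id t).add_const 1).const_mul (-C₁)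
    exact (h1.exp.const_mul c).mul (hHd t)
  · beta_reduce
    rw [hπeq t ht]
    have h1 : Real.exp (-C₁ * (t + 1)) ≤ 1 := Real.exp_le_one_iff.2 (by nlinarith [ht.1])
    have h2 : c * Real.exp (-C₁ * (t + 1)) * g t ≤ c * 1 * g t := by
      have := hg0 t ht
      gcongr
    nlinarith
  · have h1 : Real.exp (-C₁) ≤ Real.exp (-C₁ * (t + 1)) := Real.exp_le_exp.2 (by nlinarith [ht.2])
    have h2 : H (-1 / 2) ≤ H t := hHmono ht.1
    have h3 : 0 ≤ H (-1 / 2) := hHnn _ (by norm_num)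
    calc c * Real.exp (-C₁) * w ≤ c * Real.exp (-C₁) * H (-1 / 2) := by gcongr
      _ ≤ c * Real.exp (-C₁ * (t + 1)) * H t := by gcongr

/-- Suppose v + mβ - (m₀/2)(t + 1) exceeds 1 somewhere. At its maximum the equation, the ODE for m
and the barrier inequality cancel all main terms. What remains is the slope m₀/2 of the tilt against
errors of total size m₀/4, a contradiction. -/
theorem upper_improvement {n : ℕ} (hn : 1 ≤ n) {s : ℝ} (hs0 : 0 < s) (hs1 : s < 1) (A : ℝ) :
    ∃ θ ε₀ κ : ℝ, 0 < θ ∧ 0 < ε₀ ∧ 0 < κ ∧ ∀ v : Euc n → ℝ → ℝ, UnitSolution s A ε₀ κ v →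
      volume.real (Metric.closedBall (0 : Euc n) (1 / 4)) / 2 ≤
        (∫ t in (-1 : ℝ)..(-1 / 2), ∫ z in Metric.closedBall (0 : Euc n) (1 / 4), (1 - v z t)) →
      ∀ x, ‖x‖ ≤ 1 / 4 → ∀ t ∈ Icc (-1 / 2 : ℝ) 0, v x t ≤ 1 - θ := by
  obtain ⟨β, G, K, hK, hβ, h0, h1, h2, h3, hG, hT⟩ := exists_cutoff n
  obtain ⟨C₁, η, ρ, hC₁, hη, hρ, -, hbar⟩ := cutoff_barrier hn hs0 hs1 hK hβ h0 h1 h2 hT A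
  set c := fracLaplacianConst n s with hc
  have hc0 : 0 < c := fracLaplacianConst_pos n hs0 hs1
  set W := volume.real (Metric.closedBall (0 : Euc n) (1 / 4)) with hW
  have hW0 : 0 < W := ENNReal.toReal_pos (Metric.measure_closedBall_pos _ _ (by norm_num)).ne'
        measure_closedBall_lt_top.ne
  set T₀ := 2 ^ s * ∫ y in {y : Euc n | 1 / 4 < ‖y‖}, 1 / ‖y‖ ^ ((n : ℝ) + s) with hT₀
  have hT₀' : 0 ≤ T₀ := mul_nonneg (by positivity) (integral_nonneg fun y => by positivity)
  -- The fraction η' of the mass is small enough for the loss cη'Wm, caused by mβ itself on B_{1/4},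
  -- to be covered by the barrier's gain mη.
  obtain ⟨η', hη'0, hη'1, hη'⟩ : ∃ η' : ℝ, 0 < η' ∧ η' ≤ 1 ∧ c * η' * W ≤ η := by
    refine ⟨min 1 (η / (c * W)), by positivity, min_le_left _ _, ?_⟩
    calc c * min 1 (η / (c * W)) * W ≤ c * (η / (c * W)) * W := by
          gcongr
          exact min_le_right _ _
      _ = η := by field_simp
  set m₀ := c * η' * Real.exp (-C₁) * (W / 2) with hm₀
  have hm₀0 : 0 < m₀ := by positivity
  -- Since m ≥ m₀ after time -1/2 and the tilt costs at most m₀/2, the gain θ = m₀/2 is left. The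
  -- forcing ε₀ and the tail cκT₀ may each use m₀/8.
  refine ⟨m₀ / 2, m₀ / 8, m₀ / (8 * (c * T₀ + 1)), by positivity, by positivity, by positivity,
    fun v hv hmass => ?_⟩
  set κ := m₀ / (8 * (c * T₀ + 1)) with hκ
  have hκ0 : 0 < κ := by positivity
  have hκT : c * κ * T₀ ≤ m₀ / 8 := by
    rw [hκ, ← sub_nonneg]
    have : m₀ / 8 - c * (m₀ / (8 * (c * T₀ + 1))) * T₀ = m₀ / (8 * (c * T₀ + 1)) := by
      field_simp
      ring
    rw [this]
    positivity
  obtain ⟨C, hC⟩ := hv.bounded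
  set g : ℝ → ℝ := fun t => ∫ z in Metric.closedBall (0 : Euc n) (1 / 4), (1 - v z t) with hg
  have hg0 : ∀ t ∈ Icc (-1 : ℝ) 0, 0 ≤ g t := fun t ht =>
    setIntegral_nonneg Metric.isClosed_closedBall.measurableSet fun z hz => by
      have := abs_le.1 (hv.abs_le_one z (by
        rw [mem_closedBall_zero_iff] at hz
        linarith) t ht)
      linarith
  obtain ⟨m, m', hmd, hm1, hmnn, hmode, hmlow⟩ := exists_weight hv.average_continuousOn hg0
    (c := c * η') (C₁ := C₁) (w := W / 2) (by positivity) hC₁ hmass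
  suffices hmain : ∀ x, ‖x‖ ≤ 1 / 2 → ∀ t ∈ Icc (-1 : ℝ) 0,
      v x t + m t * β x - m₀ / 2 * (t + 1) ≤ 1 by
    intro x hx t ht
    have e1 := hmain x (by linarith) t ⟨by linarith [ht.1], ht.2⟩
    have e2 := hmlow t ht
    rw [h2 x hx] at e1
    nlinarith [ht.2]
  set Ψ : Euc n × ℝ → ℝ := fun q => v q.1 q.2 + m q.2 * β q.1 - m₀ / 2 * (q.2 + 1) with hΨ
  have hmc : Continuous m := continuous_iff_continuousAt.2 fun t => (hmd t).continuousAt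
  have hΨc : ContinuousOn Ψ (Metric.closedBall 0 (1 / 2) ×ˢ Icc (-1) 0) := by
    refine ((hv.continuousOn.mono (prod_mono (Metric.closedBall_subset_ball (by norm_num))
      le_rfl)).add ?_).sub ?_
    · exact Continuous.continuousOn (by fun_prop)
    · exact Continuous.continuousOn (by fun_prop)
  obtain ⟨⟨x₀, t₀⟩, ⟨hx₀, ht₀⟩, hmax⟩ := ((isCompact_closedBall (0 : Euc n) (1 / 2)).prod
    isCompact_Icc).exists_isMaxOn ⟨(0, 0), by simp, by simp⟩ hΨc
  have hmax : ∀ x, ‖x‖ ≤ 1 / 2 → ∀ t ∈ Icc (-1 : ℝ) 0, Ψ (x, t) ≤ Ψ (x₀, t₀) := fun x hx t ht =>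
    hmax ⟨by simpa using hx, ht⟩
  have hx₀ : ‖x₀‖ ≤ 1 / 2 := by simpa using hx₀
  change t₀ ∈ Icc (-1 : ℝ) 0 at ht₀
  intro x hx t ht
  refine (hmax x hx t ht).trans ?_
  by_contra! hbig
  simp only [hΨ] at hbig hmax
  have ht1 : 0 ≤ m₀ / 2 * (t₀ + 1) := mul_nonneg (by positivity) (by linarith [ht₀.1])
  have hv0 := abs_le.1 (hv.abs_le_one x₀ (by linarith) t₀ ht₀)
  -- A value above 1 excludes the lateral boundary, where β = 0, and the initial time, where m = 0.
  have hxlt : ‖x₀‖ < 1 / 2 := by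
    by_contra! h'
    rw [h3 x₀ h', mul_zero] at hbig
    linarith
  have htlt : -1 < t₀ := by
    rcases ht₀.1.lt_or_eq with h' | h'
    · exact h'
    · rw [← h', hm1, zero_mul] at hbig
      rw [← h'] at hv0
      linarith
  have hm0 : 0 ≤ m t₀ := hmnn t₀ ht₀
  obtain ⟨τ, L, p, hτ, hp, hL, heq⟩ := hv.equation x₀ (by linarith) t₀ ht₀
  have htime : 0 ≤ τ + m' t₀ * β x₀ - m₀ / 2 := by
    refine nonneg_of_hasDerivWithinAt_of_max htlt ht₀.2 (f := fun t => v x₀ t + m t * β x₀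
      - m₀ / 2 * (t + 1)) ?_ fun r hr => hmax x₀ hx₀ r hr
    have e1 : HasDerivAt (fun t : ℝ => m₀ / 2 * (t + 1)) (m₀ / 2) t₀ := by
      simpa using ((hasDerivAt_id t₀).add_const 1).const_mul (m₀ / 2)
    exact (hτ.add ((hmd t₀).mul_const (β x₀)).hasDerivWithinAt).sub e1.hasDerivWithinAt
  have hgrad : ‖p‖ = m t₀ * ‖G x₀‖ := by
    have hloc : IsLocalMax (fun y => v y t₀ + m t₀ * β y) x₀ := by
      have : Metric.ball (0 : Euc n) (1 / 2) ∈ 𝓝 x₀ := Metric.isOpen_ball.mem_nhds (by simpa using hxlt)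
      filter_upwards [this] with y hy
      have hy' : ‖y‖ < 1 / 2 := by simpa using hy
      have := hmax y hy'.le t₀ ht₀
      linarith
    have e1 := (hasGradientAt_iff_hasFDerivAt.1 hp).add
      ((hasGradientAt_iff_hasFDerivAt.1 (hG x₀)).const_mul (m t₀))
    have e2 := hloc.hasFDerivAt_eq_zero e1
    have e3 : p = -(m t₀ • G x₀) := by
      rw [← LinearIsometryEquiv.map_smul, ← map_add] at e2
      exact eq_neg_of_add_eq_zero_left ((LinearIsometryEquiv.map_eq_zero_iff _).1 e2)
    rw [e3, norm_neg, norm_smul, Real.norm_of_nonneg hm0]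
  have hfrac := fracLaplacian_lower_bound hn hs0 hs1 hβ h0 h1 h2 h3 (w := fun z => v z t₀)
    (κ := κ) (η := η') (D := A * ‖G x₀‖ + η - C₁ * β x₀) (C := C) hx₀ hm0 hκ0.le hη'0.le hη'1 hρ
    (hv.aemeasurable t₀ ht₀) (fun z => hC z t₀ ht₀) (fun z hz => ?_) (by linarith)
    (fun z hz => (abs_le.1 (hv.abs_le_one z hz t₀ ht₀)).1)
    (fun z hz => (abs_le.1 (hv.abs_le_growth z hz t₀ ht₀)).2)
    (fun ε hε hερ => by linarith [hbar x₀ hx₀ ε hε hερ]) hL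
  · rw [← hc, ← hT₀, ← hW] at hfrac
    change c * η' * (g t₀ - m t₀ * W) + _ - _ ≤ L at hfrac
    have e1 := (abs_le.1 heq).2
    rw [hgrad] at e1
    have e2 : m' t₀ * β x₀ ≤ (c * η' * g t₀ - C₁ * m t₀) * β x₀ :=
      mul_le_mul_of_nonneg_right (hmode t₀ ht₀) (h0 x₀)
    have e3 : c * η' * g t₀ * β x₀ ≤ c * η' * g t₀ :=
      mul_le_of_le_one_right (mul_nonneg (by positivity) (hg0 t₀ ht₀)) (h1 x₀)
    have e4 : m t₀ * (c * η' * W) ≤ m t₀ * η := by gcongr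
    nlinarith
  -- Maximality is known only on the closed ball of radius 1/2. In the rest of the unit ball β = 0
  -- and v ≤ 1, which lies below the maximum.
  · rcases le_or_gt ‖z‖ (1 / 2) with hz' | hz'
    · have := hmax z hz' t₀ ht₀
      linarith
    · have := abs_le.1 (hv.abs_le_one z hz t₀ ht₀)
      rw [h3 z hz'.le, mul_zero]
      linarith

/-- Diminish of oscillation at unit scale. -/
theorem oscillation_improvement {n : ℕ} (hn : 1 ≤ n) {s : ℝ} (hs0 : 0 < s) (hs1 : s < 1) (A : ℝ) :
    ∃ θ ε₀ κ : ℝ, 0 < θ ∧ 0 < ε₀ ∧ 0 < κ ∧ ∀ v : Euc n → ℝ → ℝ, UnitSolution s A ε₀ κ v →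
      (∀ x, ‖x‖ ≤ 1 / 4 → ∀ t ∈ Icc (-1 / 2 : ℝ) 0, v x t ≤ 1 - θ) ∨
      (∀ x, ‖x‖ ≤ 1 / 4 → ∀ t ∈ Icc (-1 / 2 : ℝ) 0, -(1 - θ) ≤ v x t) := by
  obtain ⟨θ, ε₀, κ, hθ, hε₀, hκ, h⟩ := upper_improvement hn hs0 hs1 A
  refine ⟨θ, ε₀, κ, hθ, hε₀, hκ, fun v hv => ?_⟩
  set W := volume.real (Metric.closedBall (0 : Euc n) (1 / 4)) with hW
  have hint : ∀ v : Euc n → ℝ → ℝ, UnitSolution s A ε₀ κ v → IntervalIntegrable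
      (fun t => ∫ z in Metric.closedBall (0 : Euc n) (1 / 4), (1 - v z t)) volume
      (-1) (-1 / 2) := fun v hv => by
    refine (hv.average_continuousOn.mono ?_).intervalIntegrable
    rw [uIcc_of_le (by norm_num)]
    exact Icc_subset_Icc_right (by norm_num)
  -- The masses of 1 - v and 1 + v add up to 2W at each time, hence to W over a time interval of
  -- length 1/2; one of them is at least W/2.
  have hsum : (∫ t in (-1 : ℝ)..(-1 / 2),
      ∫ z in Metric.closedBall (0 : Euc n) (1 / 4), (1 - v z t)) +
      (∫ t in (-1 : ℝ)..(-1 / 2),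
      ∫ z in Metric.closedBall (0 : Euc n) (1 / 4), (1 - -v z t)) = W := by
    rw [← intervalIntegral.integral_add (hint v hv) (hint _ hv.neg)]
    have : ∫ t in (-1 : ℝ)..(-1 / 2), ((∫ z in Metric.closedBall (0 : Euc n) (1 / 4), (1 - v z t))
        + ∫ z in Metric.closedBall (0 : Euc n) (1 / 4), (1 - -v z t)) =
        ∫ t in (-1 : ℝ)..(-1 / 2), 2 * W := by
      refine intervalIntegral.integral_congr fun t ht => ?_
      rw [uIcc_of_le (by norm_num)] at ht
      have ht' : t ∈ Icc (-1 : ℝ) 0 := ⟨ht.1, by linarith [ht.2]⟩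
      have hi : IntegrableOn (fun z => v z t) (Metric.closedBall (0 : Euc n) (1 / 4)) := by
        obtain ⟨C, hC⟩ := hv.bounded
        exact Measure.integrableOn_of_bounded (M := C) measure_closedBall_lt_top.ne
          (hv.aemeasurable t ht').aestronglyMeasurable (Eventually.of_forall fun z => hC z t ht')
      have h1 : IntegrableOn (fun _ => (1 : ℝ)) (Metric.closedBall (0 : Euc n) (1 / 4)) :=
        integrableOn_const measure_closedBall_lt_top.ne
      change (∫ z in Metric.closedBall (0 : Euc n) (1 / 4), (1 - v z t))
        + ∫ z in Metric.closedBall (0 : Euc n) (1 / 4), (1 - -v z t) = 2 * W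
      have hi' : IntegrableOn (fun z => -v z t) (Metric.closedBall (0 : Euc n) (1 / 4)) := hi.neg
      rw [integral_sub h1 hi, integral_sub h1 hi', integral_neg, setIntegral_const, smul_eq_mul,
        ← hW]
      ring
    rw [this, intervalIntegral.integral_const, smul_eq_mul]
    ring
  rcases le_or_gt (W / 2) (∫ t in (-1 : ℝ)..(-1 / 2),
      ∫ z in Metric.closedBall (0 : Euc n) (1 / 4), (1 - v z t)) with h1 | h1
  · exact Or.inl (h v hv h1)
  · right
    intro x hx t ht
    have := h _ hv.neg (by linarith) x hx t ht
    linarith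

/-! ### Rescaling in a moving frame. -/

-- The substitution y ↦ ry turns truncation at ε into truncation at rε, so the principal value
-- persists; the homogeneity of the kernel and the Jacobian r^n combine to r^(2s).
open scoped Pointwise in
theorem HasFracLaplacianAt.comp_affine {n : ℕ} {s L r : ℝ} {w : Euc n → ℝ} {z x : Euc n}
    (hr : 0 < r) (a d : ℝ) (h : HasFracLaplacianAt s w (z + r • x) L) :
    HasFracLaplacianAt s (fun y => a * (w (z + r • y) - d)) x (a * r ^ (2 * s) * L) := by
  unfold HasFracLaplacianAt at h ⊢
  have hlim : Tendsto (fun ε : ℝ => r * ε) (𝓝[>] 0) (𝓝[>] 0) := by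
    refine tendsto_nhdsWithin_iff.2 ⟨?_, ?_⟩
    · have : Continuous fun ε : ℝ => r * ε := by fun_prop
      simpa using (this.tendsto 0).mono_left (nhdsWithin_le_nhds (s := Ioi 0))
    · filter_upwards [self_mem_nhdsWithin] with ε hε
      exact mul_pos hr hε
  refine ((h.comp hlim).const_mul (a * r ^ (2 * s))).congr fun ε => ?_
  set F : Euc n → ℝ := fun y => (w (z + r • x) - w (z + r • x + y)) / ‖y‖ ^ ((n : ℝ) + 2 * s)
    with hF
  have hset : r • {y : Euc n | ε < ‖y‖} = {y : Euc n | r * ε < ‖y‖} := by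
    ext y
    rw [mem_smul_set_iff_inv_smul_mem₀ hr.ne', mem_ofPred_eq, mem_ofPred_eq, norm_smul, norm_inv,
      Real.norm_of_nonneg hr.le, ← div_eq_inv_mul, lt_div_iff₀ hr, mul_comm]
  have hch := Measure.setIntegral_comp_smul_of_pos (volume : Measure (Euc n)) F
    {y : Euc n | ε < ‖y‖} hr
  rw [hset, finrank_euclideanSpace_fin, smul_eq_mul] at hch
  have hint : ∀ y, (a * (w (z + r • x) - d) - a * (w (z + r • (x + y)) - d)) /
      ‖y‖ ^ ((n : ℝ) + 2 * s) = a * r ^ ((n : ℝ) + 2 * s) * F (r • y) := fun y => by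
    have hrp : r ^ ((n : ℝ) + 2 * s) ≠ 0 := (Real.rpow_pos_of_pos hr _).ne'
    simp only [hF]
    rw [norm_smul, Real.norm_of_nonneg hr.le, Real.mul_rpow hr.le (norm_nonneg y), smul_add,
      ← add_assoc, mul_assoc, mul_div_assoc', mul_div_mul_left _ _ hrp]
    ring
  simp only [hint, Function.comp]
  rw [integral_const_mul, hch, Real.rpow_add hr, Real.rpow_natCast]
  have : r ^ n ≠ 0 := by positivity
  field_simp

/-- A classical solution, seen in a moving frame at scale `r`, solves the unit scale inequality. -/
theorem IsClassicalSolution.rescale {n : ℕ} {s : ℝ}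
    {b : Euc n → ℝ → Euc n} {f u : Euc n → ℝ → ℝ} {A F U r a d ε₀ κ : ℝ} {V V' : ℝ → Euc n}
    (h : IsClassicalSolution s b f u) (hs0 : 0 < s) (hr : 0 < r) (hr1 : r ≤ 1) (ha : 0 < a)
    (hF : ∀ x ∈ Metric.ball (0 : Euc n) 1, ∀ t ∈ Icc (-1 : ℝ) 0, |f x t| ≤ F)
    (hU : ∀ x : Euc n, ∀ t ∈ Icc (-1 : ℝ) 0, |u x t| ≤ U)
    (hV : ∀ t, HasDerivAt V (V' t) t)
    (hVr : ∀ t ∈ Icc (-r ^ (2 * s)) 0, ‖V t‖ + r ≤ 1)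
    (hdrift : ∀ t ∈ Icc (-r ^ (2 * s)) 0, ∀ x : Euc n, ‖x‖ < 1 →
      ‖b (V t + r • x) t + V' t‖ ≤ A * r ^ (1 - 2 * s))
    (hε₀ : a * r ^ (2 * s) * F ≤ ε₀)
    (hin : ∀ x : Euc n, ‖x‖ < 1 → ∀ t ∈ Icc (-r ^ (2 * s)) 0, a * |u (V t + r • x) t - d| ≤ 1)
    (hout : ∀ x : Euc n, 1 ≤ ‖x‖ → ∀ t ∈ Icc (-r ^ (2 * s)) 0,
      a * |u (V t + r • x) t - d| ≤ 1 + κ * ‖x‖ ^ s) :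
    UnitSolution s A ε₀ κ
      (fun x t => a * (u (V (r ^ (2 * s) * t) + r • x) (r ^ (2 * s) * t) - d)) := by
  set q := r ^ (2 * s) with hq
  have hq0 : 0 < q := Real.rpow_pos_of_pos hr _
  have hq1 : q ≤ 1 := Real.rpow_le_one hr.le hr1 (by positivity)
  have hqt : ∀ t ∈ Icc (-1 : ℝ) 0, q * t ∈ Icc (-q) 0 := fun t ht =>
    ⟨by nlinarith [ht.1], mul_nonpos_of_nonneg_of_nonpos hq0.le ht.2⟩
  have hqI : Icc (-q) 0 ⊆ Icc (-1 : ℝ) 0 := Icc_subset_Icc_left (by linarith)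
  have hVc : Continuous V := continuous_iff_continuousAt.2 fun t => (hV t).continuousAt
  have hball : ∀ t ∈ Icc (-q) 0, ∀ x : Euc n, ‖x‖ < 1 → V t + r • x ∈ Metric.ball (0 : Euc n) 1 :=
    fun t ht x hx => by
      rw [mem_ball_zero_iff]
      refine (norm_add_le _ _).trans_lt ?_
      rw [norm_smul, Real.norm_of_nonneg hr.le]
      have := hVr t ht
      nlinarith
  refine ⟨fun t ht => ?_, ⟨a * (U + |d|), fun x t ht => ?_⟩, ?_, fun x hx t ht => ?_,
    fun x hx t ht => ?_, fun x hx t ht => ?_⟩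
  · have h1 := h.aemeasurable (q * t) (hqI (hqt t ht))
    have h2 : Measure.QuasiMeasurePreserving (fun x : Euc n => V (q * t) + r • x) volume volume :=
      (measurePreserving_add_left volume (V (q * t))).quasiMeasurePreserving.comp
        (Measure.quasiMeasurePreserving_smul (volume : Measure (Euc n)) hr.ne')
    exact ((h1.comp_quasiMeasurePreserving h2).sub_const d).const_mul a
  · rw [abs_mul, abs_of_pos ha]
    gcongr
    exact (abs_sub _ _).trans (by gcongr; exact hU _ _ (hqI (hqt t ht)))
  · refine ContinuousOn.mul continuousOn_const (ContinuousOn.sub ?_ continuousOn_const)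
    refine h.differentiableOn.continuousOn.comp
      (f := fun p : Euc n × ℝ => (V (q * p.2) + r • p.1, q * p.2)) ?_ fun p hp => ?_
    · exact Continuous.continuousOn (by fun_prop)
    · exact ⟨hball _ (hqt _ hp.2) _ (by simpa using hp.1), hqI (hqt _ hp.2)⟩
  · rw [abs_mul, abs_of_pos ha]
    exact hin x hx _ (hqt t ht)
  · rw [abs_mul, abs_of_pos ha]
    exact hout x hx _ (hqt t ht)
  · have hT := hqt t ht
    have hT1 := hqI hT
    have hX := hball _ hT x hx
    set T := q * t with hTdef
    set X := V T + r • x with hXdef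
    have hD := (h.differentiableOn (X, T) ⟨hX, hT1⟩).hasFDerivWithinAt
    set D := fderivWithin ℝ (fun p : Euc n × ℝ => u p.1 p.2)
      (Metric.ball 0 1 ×ˢ Icc (-1) 0) (X, T) with hDdef
    obtain ⟨L, hL, heq⟩ := h.equation X hX T hT1
    -- spatial gradient
    have hsp : HasFDerivAt (fun y => u y T) (D.comp (ContinuousLinearMap.inl ℝ (Euc n) ℝ)) X := by
      have hmaps : MapsTo (fun y : Euc n => (y, T)) (Metric.ball 0 1)
          (Metric.ball 0 1 ×ˢ Icc (-1) 0) := fun y hy => ⟨hy, hT1⟩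
      exact (HasFDerivWithinAt.comp X (f := fun y : Euc n => (y, T)) hD
        (hasFDerivAt_prodMk_left X T).hasFDerivWithinAt hmaps).hasFDerivAt
        (Metric.isOpen_ball.mem_nhds hX)
    have hgr := hsp.differentiableAt.hasGradientAt
    set P := gradient (fun y => u y T) X with hP
    have hPD : ∀ y, inner ℝ P y = D (y, 0) := fun y => by
      have := (hasGradientAt_iff_hasFDerivAt.1 hgr).unique hsp
      have := DFunLike.congr_fun this y
      simpa using this
    -- time derivative
    have htm : derivWithin (fun τ => u X τ) (Icc (-1) 0) T = D (0, 1) := by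
      have h1 : HasDerivWithinAt (fun τ : ℝ => (X, τ)) (0, 1) (Icc (-1) 0) T :=
        (hasDerivWithinAt_const T _ X).prodMk (hasDerivWithinAt_id T _)
      have h2 := hD.comp_hasDerivWithinAt T h1 fun τ hτ => ⟨hX, hτ⟩
      exact h2.derivWithin (uniqueDiffOn_Icc (by norm_num) T hT1)
    -- Differentiating along the moving path needs the joint derivative D; the partial derivatives
    -- alone would not suffice.
    have hpath : HasDerivWithinAt (fun τ => a * (u (V (q * τ) + r • x) (q * τ) - d))
        (a * D (q • V' T, q)) (Icc (-1) 0) t := by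
      have h1 : HasDerivAt (fun τ : ℝ => q * τ) q t := by
        simpa using (hasDerivAt_id t).const_mul q
      have h2 : HasDerivAt (fun τ => V (q * τ) + r • x) (q • V' T) t :=
        ((hV T).scomp t h1).add_const _
      have hmaps : MapsTo (fun τ => (V (q * τ) + r • x, q * τ)) (Icc (-1) 0)
          (Metric.ball (0 : Euc n) 1 ×ˢ Icc (-1) 0) :=
        fun τ hτ => ⟨hball _ (hqt τ hτ) x hx, hqI (hqt τ hτ)⟩
      have h3 := HasFDerivWithinAt.comp_hasDerivWithinAt t
        (f := fun τ => (V (q * τ) + r • x, q * τ)) hD (h2.prodMk h1).hasDerivWithinAt hmaps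
      exact (h3.sub_const d).const_mul a
    have hDsplit : D (q • V' T, q) = q * (inner ℝ P (V' T) + D (0, 1)) := by
      have : ((q • V' T, q) : Euc n × ℝ) = q • ((V' T, 0) + (0, 1)) := by simp
      rw [this, map_smul, map_add, hPD, smul_eq_mul]
    refine ⟨a * D (q • V' T, q), a * q * L, (a * r) • P, hpath, ?_, hL.comp_affine hr a d, ?_⟩
    · rw [hasGradientAt_iff_hasFDerivAt] at hgr ⊢
      have h1 : HasFDerivAt (fun y : Euc n => V T + r • y) (r • ContinuousLinearMap.id ℝ (Euc n)) x :=
        ((hasFDerivAt_id x).const_smul r).const_add _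
      have h2 := ((HasFDerivAt.comp x hgr h1).sub_const d).const_mul a
      refine h2.congr_fderiv ?_
      ext y
      simp
      ring
    · rw [hDsplit, ← htm]
      have e1 : a * (q * (inner ℝ P (V' T) + derivWithin (fun τ => u X τ) (Icc (-1) 0) T)) +
          a * q * L = a * q * (inner ℝ (b X T + V' T) P + f X T) := by
        rw [← heq, inner_add_left, real_inner_comm (V' T) P]
        ring
      rw [e1, abs_mul, abs_of_pos (by positivity : 0 < a * q), norm_smul,
        Real.norm_of_nonneg (by positivity : 0 ≤ a * r)]
      have e2 : |inner ℝ (b X T + V' T) P + f X T| ≤ A * r ^ (1 - 2 * s) * ‖P‖ + F := by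
        refine (abs_add_le _ _).trans (add_le_add ?_ (hF X hX T hT1))
        refine (abs_real_inner_le_norm _ _).trans ?_
        gcongr
        exact hdrift T hT x hx
      -- Critical scaling: time contributes q = r^(2s) and the drift bound r^(1-2s), whose product
      -- is the factor r in the rescaled gradient.
      have e3 : q * r ^ (1 - 2 * s) = r := by
        rw [hq, ← Real.rpow_add hr]
        simp
      calc a * q * |inner ℝ (b X T + V' T) P + f X T|
          ≤ a * q * (A * r ^ (1 - 2 * s) * ‖P‖ + F) := by gcongr
        _ = A * (a * (q * r ^ (1 - 2 * s)) * ‖P‖) + a * q * F := by ring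
        _ ≤ _ := by rw [e3]; gcongr

/-! ### Approximate characteristics. -/

/-- Approximate characteristics `V' ≈ -b(V, t)`, `V(0) = 0`, by a delayed equation. -/
theorem exists_approximate_characteristic {n : ℕ} {b : Euc n → ℝ → Euc n} {B T γ δ : ℝ}
    (hB : 0 ≤ B) (hT0 : 0 ≤ T) (hT1 : T ≤ 1) (hBT : B * T < 1) (hγ : 0 < γ) (hδ : 0 < δ)
    (hb : ∀ x ∈ Metric.ball (0 : Euc n) 1, ∀ t ∈ Icc (-1 : ℝ) 0, ‖b x t‖ ≤ B)
    (hc : ContinuousOn (fun p : Euc n × ℝ => b p.1 p.2) (Metric.ball 0 1 ×ˢ Icc (-1) 0))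
    (hh : ∀ x ∈ Metric.ball (0 : Euc n) 1, ∀ y ∈ Metric.ball (0 : Euc n) 1,
      ∀ t ∈ Icc (-1 : ℝ) 0, ‖b x t - b y t‖ ≤ B * ‖x - y‖ ^ γ) :
    ∃ V V' : ℝ → Euc n, (∀ t, HasDerivAt V (V' t) t) ∧ (∀ t, ‖V t‖ ≤ B * |t|) ∧
      ∀ t ∈ Icc (-T) 0, ‖b (V t) t + V' t‖ ≤ δ := by
  obtain ⟨h, hh0, hhδ⟩ : ∃ h : ℝ, 0 < h ∧ B * (B * h) ^ γ ≤ δ := by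
    have hcont : Continuous fun h : ℝ => B * (B * h) ^ γ :=
      continuous_const.mul ((continuous_const.mul continuous_id).rpow_const fun _ => Or.inr hγ.le)
    have ht := (hcont.tendsto 0).mono_left (nhdsWithin_le_nhds (s := Ioi 0))
    rw [mul_zero, Real.zero_rpow hγ.ne', mul_zero] at ht
    obtain ⟨h, h1, h2⟩ := ((ht.eventually (eventually_le_nhds hδ)).and self_mem_nhdsWithin).exists
    exact ⟨h, h2, h1⟩
  set π : ℝ → ℝ := fun t => max (-T) (min t 0) with hπ
  have hπmem : ∀ t, π t ∈ Icc (-T) 0 := fun t => by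
    simp only [hπ, mem_Icc]
    exact ⟨le_max_left _ _, max_le (by linarith) (min_le_right _ _)⟩
  have hπeq : ∀ t ∈ Icc (-T) 0, π t = t := fun t ht => by
    simp only [hπ]
    rw [min_eq_left ht.2, max_eq_right ht.1]
  -- The field is evaluated at the position occupied h later, closer to time 0. As the curve is
  -- built backwards from 0, that position is already known.
  set σ : ℝ → ℝ := fun t => min (π t + h) 0 with hσ
  have hσmem : ∀ t, σ t ∈ Icc (-T) 0 := fun t => by
    simp only [hσ, mem_Icc]
    exact ⟨le_min (by linarith [(hπmem t).1]) (by linarith), min_le_right _ _⟩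
  set Φ : (ℝ → Euc n) → ℝ → Euc n := fun W t => ∫ τ in (0 : ℝ)..t, -b (W (σ τ)) (π τ) with hΦ
  have hmem : ∀ W : ℝ → Euc n, (∀ t, ‖W t‖ ≤ B * |t|) → ∀ t ∈ Icc (-T) 0,
      W t ∈ Metric.ball (0 : Euc n) 1 := fun W hW t ht => by
    rw [mem_ball_zero_iff]
    refine (hW t).trans_lt (lt_of_le_of_lt ?_ hBT)
    rw [abs_of_nonpos ht.2]
    gcongr
    linarith [ht.1]
  have hIcc : ∀ t ∈ Icc (-T) 0, t ∈ Icc (-1 : ℝ) 0 := fun t ht => ⟨by linarith [ht.1], ht.2⟩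
  have hstep : ∀ W : ℝ → Euc n, Continuous W → (∀ t, ‖W t‖ ≤ B * |t|) →
      (∀ t, HasDerivAt (Φ W) (-b (W (σ t)) (π t)) t) ∧
      ∀ t t', ‖Φ W t - Φ W t'‖ ≤ B * |t - t'| := by
    intro W hWc hW
    have hgc : Continuous fun τ => -b (W (σ τ)) (π τ) := by
      refine (hc.comp_continuous (f := fun τ => (W (σ τ), π τ)) (by fun_prop) fun τ => ?_).neg
      exact ⟨hmem W hW _ (hσmem τ), hIcc _ (hπmem τ)⟩
    have hd : ∀ t, HasDerivAt (Φ W) (-b (W (σ t)) (π t)) t := fun t =>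
      intervalIntegral.integral_hasDerivAt_right (hgc.intervalIntegrable _ _)
        (hgc.stronglyMeasurableAtFilter _ _) hgc.continuousAt
    refine ⟨hd, fun t t' => ?_⟩
    have := convex_univ.norm_image_sub_le_of_norm_hasDerivWithin_le (C := B) (x := t') (y := t)
      (fun τ _ => (hd τ).hasDerivWithinAt) (fun τ _ => ?_) (mem_univ _) (mem_univ _)
    · simpa using this
    · rw [norm_neg]
      exact hb _ (hmem W hW _ (hσmem τ)) _ (hIcc _ (hπmem τ))
  have hΦ0 : ∀ W, Φ W 0 = 0 := fun W => by simp [hΦ]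
  have hgood : ∀ k : ℕ, Continuous (Φ^[k] 0) ∧ ∀ t, ‖Φ^[k] 0 t‖ ≤ B * |t| := by
    intro k
    induction k with
    | zero => exact ⟨continuous_const, fun t => by simpa using mul_nonneg hB (abs_nonneg t)⟩
    | succ k ih =>
      rw [Function.iterate_succ_apply']
      obtain ⟨h1, h2⟩ := hstep _ ih.1 ih.2
      refine ⟨continuous_iff_continuousAt.2 fun t => (h1 t).continuousAt, fun t => ?_⟩
      simpa [hΦ0] using h2 t 0
  -- Method of steps: each iteration of Φ settles the curve on one more interval of length h, so
  -- finitely many iterations reach an exact solution of the delayed equation on [-T, 0].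
  have hagree : ∀ k : ℕ, ∀ t ∈ Icc (-T) 0, -(k * h) ≤ t → Φ^[k] 0 t = Φ^[k + 1] 0 t := by
    intro k
    induction k with
    | zero =>
      intro t ht htk
      have : t = 0 := le_antisymm ht.2 (by simpa using htk)
      rw [this, Function.iterate_succ_apply', hΦ0]
      rfl
    | succ k ih =>
      intro t ht htk
      rw [Function.iterate_succ_apply' Φ (k + 1), Function.iterate_succ_apply' Φ k]
      refine intervalIntegral.integral_congr fun τ hτ => ?_
      rw [uIcc_of_ge ht.2] at hτ
      have hτ' : τ ∈ Icc (-T) 0 := ⟨ht.1.trans hτ.1, hτ.2⟩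
      have : -(k * h) ≤ σ τ := by
        simp only [hσ]
        rw [hπeq τ hτ']
        refine le_min ?_ (by simpa using by positivity)
        push_cast at htk
        linarith [hτ.1]
      beta_reduce
      rw [ih _ (hσmem τ) this, Function.iterate_succ_apply' Φ k]
  obtain ⟨N, hN⟩ := exists_nat_ge (T / h)
  rw [div_le_iff₀ hh0] at hN
  obtain ⟨g1, g2⟩ := hgood N
  obtain ⟨d1, d2⟩ := hstep _ g1 g2
  have g3 := (hgood (N + 1)).2
  rw [Function.iterate_succ_apply'] at g3
  refine ⟨Φ (Φ^[N] 0), _, d1, g3, fun t ht => ?_⟩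
  rw [hπeq t ht, hagree N (σ t) (hσmem t) (by linarith [(hσmem t).1]),
    Function.iterate_succ_apply', ← sub_eq_add_neg]
  set W := Φ (Φ^[N] 0) with hW
  refine (hh _ (hmem W g3 t ht) _ (hmem W g3 _ (hσmem t)) t (hIcc t ht)).trans (le_trans ?_ hhδ)
  gcongr
  refine (d2 t (σ t)).trans ?_
  gcongr
  simp only [hσ]
  rw [hπeq t ht, abs_le]
  constructor
  · linarith [min_le_left (t + h) 0]
  · have : t ≤ min (t + h) 0 := le_min (by linarith) ht.2
    linarith

/-! ### Iteration over scales. -/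

/-- Bernoulli's inequality for the exponent α/s ≤ 1, applied to (y/λ)^s. It turns the growth of the
oscillation over earlier scales into the exterior bound required at unit scale. -/
theorem two_rpow_sub_one_le {s α κ lam y : ℝ} (hs : 0 < s) (hα0 : 0 < α) (hαs : α ≤ s)
    (hlam : 0 < lam) (hκ : 2 * (α / s) * lam ^ (-s) ≤ κ) (hy : 1 ≤ y) :
    2 * (y / lam) ^ α - 1 ≤ 1 + κ * y ^ s := by
  have hy0 : 0 < y := by linarith
  have hq : 0 < y / lam := by positivity
  have h1 := rpow_one_add_le_one_add_mul_self (s := (y / lam) ^ s - 1) (p := α / s)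
    (by linarith [Real.rpow_nonneg hq.le s]) (by positivity) ((div_le_one hs).2 hαs)
  rw [add_sub_cancel, ← Real.rpow_mul hq.le, mul_div_cancel₀ _ hs.ne'] at h1
  have h2 : (y / lam) ^ s = lam ^ (-s) * y ^ s := by
    rw [Real.div_rpow hy0.le hlam.le, Real.rpow_neg hlam.le, div_eq_inv_mul]
  have h3 : 2 * (α / s) * lam ^ (-s) * y ^ s ≤ κ * y ^ s := by gcongr
  have h4 : 0 < α / s := by positivity
  rw [h2] at h1
  nlinarith

/-- The order of choice matters: λ is fixed first, by geometry alone. As α → 0, λ^α tends to 1 and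
αλ^(-s) to 0, so the gain θ and the tail allowance κ are both respected. -/
theorem exists_scale_exponent {s θ κ : ℝ} (hs0 : 0 < s) (hθ : 0 < θ) (hκ : 0 < κ) :
    ∃ lam α : ℝ, 0 < lam ∧ lam ≤ 1 / 4 ∧ lam ^ (2 * s) ≤ 1 / 2 ∧ 0 < α ∧ α ≤ s ∧
      1 - θ / 2 ≤ lam ^ α ∧ 2 * (α / s) * lam ^ (-s) ≤ κ := by
  obtain ⟨lam, h1, h2, h3⟩ : ∃ lam : ℝ, 0 < lam ∧ lam ≤ 1 / 4 ∧ lam ^ (2 * s) ≤ 1 / 2 := by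
    have hcont : Continuous fun l : ℝ => l ^ (2 * s) :=
      continuous_id.rpow_const fun _ => Or.inr (by positivity)
    have ht := (hcont.tendsto 0).mono_left (nhdsWithin_le_nhds (s := Ioi 0))
    rw [Real.zero_rpow (by positivity)] at ht
    have e2 : ∀ᶠ l : ℝ in 𝓝[>] 0, l ∈ Ioo (0 : ℝ) (1 / 4) := Ioo_mem_nhdsGT (by norm_num)
    obtain ⟨l, h1, h2⟩ := ((ht.eventually (eventually_le_nhds (by norm_num : (0 : ℝ) < 1 / 2))).and
      e2).exists
    exact ⟨l, h2.1, h2.2.le, h1⟩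
  have t1 : Tendsto (fun α : ℝ => lam ^ α) (𝓝[>] 0) (𝓝 1) := by
    have := ((Real.continuous_const_rpow h1.ne').tendsto 0).mono_left
      (nhdsWithin_le_nhds (s := Ioi 0))
    simpa using this
  have t2 : Tendsto (fun α : ℝ => 2 * (α / s) * lam ^ (-s)) (𝓝[>] 0) (𝓝 0) := by
    have hcont : Continuous fun α : ℝ => 2 * (α / s) * lam ^ (-s) := by fun_prop
    have := (hcont.tendsto 0).mono_left (nhdsWithin_le_nhds (s := Ioi 0))
    simpa using this
  have e3 : ∀ᶠ α : ℝ in 𝓝[>] 0, α ∈ Ioo (0 : ℝ) s := Ioo_mem_nhdsGT hs0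
  obtain ⟨α, ⟨h4, h5⟩, h6⟩ := ((t1.eventually (eventually_ge_nhds (by linarith : 1 - θ / 2 < 1))).and
    (t2.eventually (eventually_le_nhds hκ))).and e3 |>.exists
  exact ⟨lam, α, h1, h2, h3, h6.1, h6.2.le, h4, h5⟩

/-- Geometric decay of the oscillation in cylinders around the curve `V`. -/
theorem oscillation_decay {n : ℕ} (hn : 1 ≤ n) {s : ℝ} (hs0 : 0 < s) (hs1 : s < 1) (A : ℝ) :
    ∃ lam α ε₀ : ℝ, 0 < lam ∧ lam < 1 ∧ 0 < α ∧ α < 1 ∧ 0 < ε₀ ∧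
      ∀ (b : Euc n → ℝ → Euc n) (f u : Euc n → ℝ → ℝ) (U F M r₀ : ℝ) (V V' : ℝ → Euc n) (k : ℕ),
        IsClassicalSolution s b f u →
        (∀ x ∈ Metric.ball (0 : Euc n) 1, ∀ t ∈ Icc (-1 : ℝ) 0, |f x t| ≤ F) →
        (∀ x : Euc n, ∀ t ∈ Icc (-1 : ℝ) 0, |u x t| ≤ U) →
        0 < M → 2 * U ≤ M → 2 * F ≤ ε₀ * M → 0 < r₀ → r₀ ≤ 1 →
        (∀ t, HasDerivAt V (V' t) t) →
        (∀ t ∈ Icc (-r₀ ^ (2 * s)) 0, ‖V t‖ + r₀ ≤ 1) →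
        (∀ j < k, ∀ t ∈ Icc (-r₀ ^ (2 * s)) 0, ∀ x : Euc n, ‖x‖ < 1 →
          ‖b (V t + (lam ^ j * r₀) • x) t + V' t‖ ≤ A * (lam ^ j * r₀) ^ (1 - 2 * s)) →
        ∃ a : ℝ, ∀ t ∈ Icc (-(lam ^ k * r₀) ^ (2 * s)) 0, ∀ x : Euc n,
          (‖x - V t‖ < lam ^ k * r₀ → a ≤ u x t ∧ u x t ≤ a + M * (lam ^ k) ^ α) ∧
          (lam ^ k * r₀ ≤ ‖x - V t‖ →
            a + M * (lam ^ k) ^ α - M * (‖x - V t‖ / (lam * r₀)) ^ α ≤ u x t ∧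
            u x t ≤ a + M * (‖x - V t‖ / (lam * r₀)) ^ α) := by
  obtain ⟨θ, ε₀, κ, hθ, hε₀, hκ, hosc⟩ := oscillation_improvement hn hs0 hs1 A
  obtain ⟨lam, α, hl0, hl4, hl2, hα0, hαs, hlθ, hlκ⟩ := exists_scale_exponent hs0 hθ hκ
  have hl1 : lam < 1 := by linarith
  refine ⟨lam, α, ε₀, hl0, hl1, hα0, by linarith, hε₀, ?_⟩
  intro b f u U F M r₀ V V' k hsol hF hU hM hMU hMF hr₀ hr₀1 hV hVr
  have hr₀s : r₀ ^ (2 * s) ≤ 1 := Real.rpow_le_one hr₀.le hr₀1 (by positivity)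
  have hF0 : 0 ≤ F := (abs_nonneg _).trans (hF 0 (by simp) 0 (by simp))
  induction k with
  | zero =>
    intro _
    refine ⟨-(M / 2), fun t ht x => ?_⟩
    simp only [pow_zero, one_mul, Real.one_rpow, mul_one] at ht ⊢
    have hu := abs_le.1 (hU x t ⟨by linarith [ht.1], ht.2⟩)
    refine ⟨fun _ => ⟨by linarith, by linarith⟩, fun hd => ?_⟩
    have h1 : 1 ≤ (‖x - V t‖ / (lam * r₀)) ^ α := by
      refine Real.one_le_rpow ?_ hα0.le
      rw [one_le_div (by positivity)]
      nlinarith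
    constructor <;> nlinarith
  | succ k ih =>
    intro hdrift
    obtain ⟨a, ha⟩ := ih fun j hj => hdrift j (by omega)
    have hdrift := hdrift k (by omega)
    set r := lam ^ k * r₀ with hr
    set Q := (lam ^ k) ^ α with hQ
    have hlk0 : 0 < lam ^ k := by positivity
    have hlk1 : lam ^ k ≤ 1 := pow_le_one₀ hl0.le hl1.le
    have hQ0 : 0 < Q := by positivity
    have hr0 : 0 < r := by positivity
    have hrr : r ≤ r₀ := mul_le_of_le_one_left hr₀.le hlk1
    have hrs0 : 0 < r ^ (2 * s) := by positivity
    have hrs : r ^ (2 * s) ≤ r₀ ^ (2 * s) := Real.rpow_le_rpow hr0.le hrr (by positivity)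
    -- Since α ≤ 2s, the rescaled forcing shrinks at least as fast as the oscillation.
    have hrQ : r ^ (2 * s) ≤ Q := by
      rw [hr, Real.mul_rpow hlk0.le hr₀.le]
      refine (mul_le_of_le_one_right (by positivity) hr₀s).trans ?_
      exact Real.rpow_le_rpow_of_exponent_ge hlk0 hlk1 (by linarith)
    have hr' : lam ^ (k + 1) * r₀ = lam * r := by rw [hr, pow_succ]; ring
    have hQ' : (lam ^ (k + 1)) ^ α = Q * lam ^ α := by
      rw [pow_succ, Real.mul_rpow hlk0.le hl0.le]
    have hI : Icc (-r ^ (2 * s)) 0 ⊆ Icc (-r₀ ^ (2 * s)) 0 := Icc_subset_Icc_left (by linarith)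
    -- The half-width of the current interval; subtracting the midpoint a + h and dividing by h
    -- normalises u to [-1, 1].
    set h := M * Q / 2 with hh
    have hh0 : 0 < h := by positivity
    have hnorm : ∀ t, ∀ x : Euc n, ‖V t + r • x - V t‖ = r * ‖x‖ := fun t x => by
      rw [add_sub_cancel_left, norm_smul, Real.norm_of_nonneg hr0.le]
    have hv := hsol.rescale (A := A) (a := 1 / h) (d := a + h) (ε₀ := ε₀) (κ := κ) (r := r) hs0 hr0
      (hrr.trans hr₀1) (by positivity) hF hU hV (fun t ht => by linarith [hVr t (hI ht)])
      (fun t ht => hdrift t (hI ht)) ?_ (fun x hx t ht => ?_) (fun x hx t ht => ?_)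
    rotate_left
    · calc 1 / h * r ^ (2 * s) * F ≤ 1 / h * Q * F := by gcongr
        _ = 2 * F / M := by rw [hh]; field_simp
        _ ≤ ε₀ := by rwa [div_le_iff₀ hM]
    · have h1 := (ha t ht (V t + r • x)).1 (by rw [hnorm]; exact mul_lt_of_lt_one_right hr0 hx)
      rw [one_div, ← div_eq_inv_mul, div_le_one hh0, abs_le]
      constructor <;> linarith
    · have h1 := (ha t ht (V t + r • x)).2 (by rw [hnorm]; exact le_mul_of_one_le_right hr0.le hx)
      rw [hnorm] at h1
      have h2 : (r * ‖x‖ / (lam * r₀)) ^ α = Q * (‖x‖ / lam) ^ α := by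
        rw [hQ, ← Real.mul_rpow hlk0.le (by positivity)]
        congr 1
        rw [hr]
        field_simp
      rw [h2] at h1
      refine le_trans ?_ (two_rpow_sub_one_le hs0 hα0 hαs hl0 hlκ hx)
      rw [one_div, ← div_eq_inv_mul, div_le_iff₀ hh0, abs_le]
      have h3 : (2 * (‖x‖ / lam) ^ α - 1) * h = M * (Q * (‖x‖ / lam) ^ α) - h := by
        rw [hh]
        ring
      rw [h3]
      constructor <;> linarith
    -- transfer of a bound in the unit cylinder
    have hback : ∀ t ∈ Icc (-(lam * r) ^ (2 * s)) 0, ∀ x : Euc n, ‖x - V t‖ < lam * r →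
        ∃ x' : Euc n, ‖x'‖ ≤ 1 / 4 ∧ ∃ t' ∈ Icc (-1 / 2 : ℝ) 0,
          V (r ^ (2 * s) * t') + r • x' = x ∧ r ^ (2 * s) * t' = t := by
      intro t ht x hx
      have e1 : r ^ (2 * s) * (t / r ^ (2 * s)) = t := by field_simp
      refine ⟨r⁻¹ • (x - V t), ?_, t / r ^ (2 * s), ⟨?_, ?_⟩, ?_, e1⟩
      · rw [norm_smul, norm_inv, Real.norm_of_nonneg hr0.le, ← div_eq_inv_mul, div_le_iff₀ hr0]
        exact hx.le.trans (by gcongr)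
      · rw [le_div_iff₀ hrs0]
        have := ht.1
        rw [Real.mul_rpow hl0.le hr0.le] at this
        have := mul_le_mul_of_nonneg_right hl2 hrs0.le
        linarith
      · exact div_nonpos_of_nonpos_of_nonneg ht.2 hrs0.le
      · rw [e1, smul_inv_smul₀ hr0.ne', add_sub_cancel]
    have hlr : lam * r ≤ r := mul_le_of_le_one_left hr0.le hl1.le
    have hIs : Icc (-(lam * r) ^ (2 * s)) 0 ⊆ Icc (-r ^ (2 * s)) 0 := Icc_subset_Icc_left <|
      neg_le_neg (Real.rpow_le_rpow (by positivity) hlr (by positivity))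
    -- it suffices to find the new interval inside the old one
    obtain ⟨a', ha1, ha2, ha'⟩ : ∃ a', a ≤ a' ∧ a' + M * (Q * lam ^ α) ≤ a + M * Q ∧
        ∀ t ∈ Icc (-(lam * r) ^ (2 * s)) 0, ∀ x : Euc n, ‖x - V t‖ < lam * r →
          a' ≤ u x t ∧ u x t ≤ a' + M * (Q * lam ^ α) := by
      have hlα : lam ^ α ≤ 1 := Real.rpow_le_one hl0.le hl1.le hα0.le
      have hMQ : M * Q = 2 * h := by rw [hh]; ring
      have hold : ∀ t ∈ Icc (-(lam * r) ^ (2 * s)) 0, ∀ x : Euc n, ‖x - V t‖ < lam * r →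
          a ≤ u x t ∧ u x t ≤ a + M * Q := fun t ht x hx =>
        (ha t (hIs ht) x).1 (hx.trans_le hlr)
      have hA : M * (Q * lam ^ α) = 2 * h * lam ^ α := by rw [← mul_assoc, hMQ]
      -- This is 1 - θ/2 ≤ λ^α: the improved width 2h - hθ fits into the prescribed 2hλ^α.
      have hB : h * (1 - lam ^ α) * 2 ≤ h * θ := by
        rw [mul_assoc]
        exact mul_le_mul_of_nonneg_left (by linarith) hh0.le
      have hC : 0 ≤ h * (1 - lam ^ α) := mul_nonneg hh0.le (by linarith)
      rw [hA]
      rw [hMQ] at hold ⊢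
      rcases hosc _ hv with hup | hlow
      · refine ⟨a, le_rfl, by linarith, fun t ht x hx => ⟨(hold t ht x hx).1, ?_⟩⟩
        obtain ⟨x', hx', t', ht', e1, e2⟩ := hback t ht x hx
        have e3 := hup x' hx' t' ht'
        rw [e1, e2, one_div, ← div_eq_inv_mul, div_le_iff₀ hh0] at e3
        linarith
      · refine ⟨a + 2 * h - 2 * h * lam ^ α, by linarith, by linarith,
          fun t ht x hx => ⟨?_, by linarith [(hold t ht x hx).2]⟩⟩
        obtain ⟨x', hx', t', ht', e1, e2⟩ := hback t ht x hx
        have e3 := hlow x' hx' t' ht'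
        rw [e1, e2, one_div, ← div_eq_inv_mul, le_div_iff₀ hh0] at e3
        linarith
    refine ⟨a', ?_⟩
    rw [hr', hQ']
    intro t ht x
    refine ⟨ha' t ht x, fun hd => ?_⟩
    rcases lt_or_ge ‖x - V t‖ r with hd' | hd'
    · have h1 := (ha t (hIs ht) x).1 hd'
      -- The denominator λr₀ in the exterior bound, rather than r₀, serves the annulus λr ≤ |x - V|
      -- < r: the new exterior bound there is already as wide as the old interior one.
      have h2 : Q ≤ (‖x - V t‖ / (lam * r₀)) ^ α := by
        refine Real.rpow_le_rpow hlk0.le ?_ hα0.le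
        rw [le_div_iff₀ (by positivity)]
        calc lam ^ k * (lam * r₀) = lam * r := by rw [hr]; ring
          _ ≤ _ := hd
      have h3 : M * Q ≤ M * (‖x - V t‖ / (lam * r₀)) ^ α := by gcongr
      constructor <;> linarith
    · have h1 := (ha t (hIs ht) x).2 hd'
      constructor <;> linarith

/-- A moving frame along which the drift is of critical size at every scale `r ∈ [r₁, r₀]`. -/
theorem exists_frame {n : ℕ} {s B r₀ r₁ : ℝ} {b : Euc n → ℝ → Euc n} (hs0 : 0 < s) (hB : 0 ≤ B)
    (hr₁ : 0 < r₁) (hr₁₀ : r₁ ≤ r₀) (hr₀ : r₀ ≤ 1 / 2) (hBr : B * r₀ ^ (2 * s) ≤ 1 / 2)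
    (hb : ∀ x ∈ Metric.ball (0 : Euc n) 1, ∀ t ∈ Icc (-1 : ℝ) 0, ‖b x t‖ ≤ B)
    (hh : s < 1 / 2 →
      ContinuousOn (fun p : Euc n × ℝ => b p.1 p.2) (Metric.ball 0 1 ×ˢ Icc (-1) 0) ∧
      ∀ x ∈ Metric.ball (0 : Euc n) 1, ∀ y ∈ Metric.ball (0 : Euc n) 1,
        ∀ t ∈ Icc (-1 : ℝ) 0, ‖b x t - b y t‖ ≤ B * ‖x - y‖ ^ (1 - 2 * s)) :
    ∃ V V' : ℝ → Euc n, (∀ t, HasDerivAt V (V' t) t) ∧ (∀ t, ‖V t‖ ≤ B * |t|) ∧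
      (∀ t ∈ Icc (-r₀ ^ (2 * s)) 0, ‖V t‖ + r₀ ≤ 1) ∧
      ∀ r, r₁ ≤ r → r ≤ r₀ → ∀ t ∈ Icc (-r₀ ^ (2 * s)) 0, ∀ x : Euc n, ‖x‖ < 1 →
        ‖b (V t + r • x) t + V' t‖ ≤ (B + 1) * r ^ (1 - 2 * s) := by
  have hr₀0 : 0 < r₀ := hr₁.trans_le hr₁₀
  have hT1 : r₀ ^ (2 * s) ≤ 1 := Real.rpow_le_one hr₀0.le (by linarith) (by positivity)
  have hT0 : 0 ≤ r₀ ^ (2 * s) := by positivity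
  have hI : ∀ t ∈ Icc (-r₀ ^ (2 * s)) 0, t ∈ Icc (-1 : ℝ) 0 := fun t ht =>
    ⟨by linarith [ht.1], ht.2⟩
  have hVb : ∀ V : ℝ → Euc n, (∀ t, ‖V t‖ ≤ B * |t|) →
      ∀ t ∈ Icc (-r₀ ^ (2 * s)) 0, ‖V t‖ ≤ 1 / 2 := fun V hV t ht => by
    refine (hV t).trans (le_trans ?_ hBr)
    rw [abs_of_nonpos ht.2]
    gcongr
    linarith [ht.1]
  have hball : ∀ V : ℝ → Euc n, (∀ t, ‖V t‖ ≤ B * |t|) →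
      ∀ t ∈ Icc (-r₀ ^ (2 * s)) 0, ∀ r, 0 < r → r ≤ r₀ → ∀ x : Euc n, ‖x‖ < 1 →
      V t + r • x ∈ Metric.ball (0 : Euc n) 1 := fun V hV t ht r hr0 hr x hx => by
    rw [mem_ball_zero_iff]
    refine (norm_add_le _ _).trans_lt ?_
    rw [norm_smul, Real.norm_of_nonneg hr0.le]
    have := hVb V hV t ht
    nlinarith
  rcases lt_or_ge s (1 / 2) with hs | hs
  · obtain ⟨hc, hh⟩ := hh hs
    -- The tolerance is set by the smallest scale r₁; as 1 - 2s > 0, it is then admissible at all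
    -- larger ones. The curve depends on r₁, the constants do not.
    obtain ⟨V, V', h1, h2, h3⟩ := exists_approximate_characteristic (γ := 1 - 2 * s)
      (δ := r₁ ^ (1 - 2 * s)) hB hT0 hT1 (by linarith) (by linarith) (by positivity) hb hc hh
    refine ⟨V, V', h1, h2, fun t ht => by linarith [hVb V h2 t ht], fun r hr hr' t ht x hx => ?_⟩
    have hr0 : 0 < r := hr₁.trans_le hr
    have e0 : b (V t + r • x) t + V' t =
        (b (V t + r • x) t - b (V t) t) + (b (V t) t + V' t) := by abel
    rw [e0, add_mul, one_mul]
    refine (norm_add_le _ _).trans (add_le_add ?_ ((h3 t ht).trans ?_))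
    · refine (hh _ (hball V h2 t ht r hr0 hr' x hx) _ (by
        rw [mem_ball_zero_iff]
        linarith [hVb V h2 t ht]) t (hI t ht)).trans ?_
      rw [add_sub_cancel_left, norm_smul, Real.norm_of_nonneg hr0.le]
      refine mul_le_mul_of_nonneg_left (Real.rpow_le_rpow (by positivity) ?_ (by linarith)) hB
      exact mul_le_of_le_one_right hr0.le hx.le
    · exact Real.rpow_le_rpow hr₁.le hr (by linarith)
  · have h2 : ∀ t : ℝ, ‖(fun _ => 0 : ℝ → Euc n) t‖ ≤ B * |t| := fun t => by
      rw [norm_zero]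
      positivity
    refine ⟨fun _ => 0, fun _ => 0, fun t => hasDerivAt_const t 0, h2,
      fun t ht => by linarith [hVb _ h2 t ht], fun r hr hr' t ht x hx => ?_⟩
    have hr0 : 0 < r := hr₁.trans_le hr
    have e1 : 1 ≤ r ^ (1 - 2 * s) :=
      Real.one_le_rpow_of_pos_of_le_one_of_nonpos hr0 (by linarith) (by linarith)
    rw [add_zero]
    refine (hb _ (hball _ h2 t ht r hr0 hr' x hx) t (hI t ht)).trans ?_
    nlinarith

/-! ### The Hölder estimate at the origin. -/

theorem exists_initial_radius {s : ℝ} (hs0 : 0 < s) (B : ℝ) :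
    ∃ r : ℝ, 0 < r ∧ r ≤ 1 / 2 ∧ B * r ^ (2 * s) ≤ 1 / 2 := by
  have hcont : Continuous fun r : ℝ => B * r ^ (2 * s) :=
    continuous_const.mul (continuous_id.rpow_const fun _ => Or.inr (by positivity))
  have ht := (hcont.tendsto 0).mono_left (nhdsWithin_le_nhds (s := Ioi 0))
  rw [Real.zero_rpow (by positivity), mul_zero] at ht
  have e2 : ∀ᶠ l : ℝ in 𝓝[>] 0, l ∈ Ioo (0 : ℝ) (1 / 2) := Ioo_mem_nhdsGT (by norm_num)
  obtain ⟨l, h1, h2⟩ := ((ht.eventually (eventually_le_nhds (by norm_num : (0 : ℝ) < 1 / 2))).and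
    e2).exists
  exact ⟨l, h2.1, h2.2.le, h1⟩

/-- Hölder continuity at the origin in terms of the parabolic size of the increment. -/
theorem holder_of_parabolic_size {n : ℕ} (hn : 1 ≤ n) {s : ℝ} (hs0 : 0 < s) (hs1 : s < 1) {B : ℝ}
    (hB : 0 ≤ B) : ∃ α C : ℝ, 0 < α ∧ α < 1 ∧ 1 ≤ C ∧
      ∀ (b : Euc n → ℝ → Euc n) (f u : Euc n → ℝ → ℝ) (U F : ℝ),
        (∀ x ∈ Metric.ball (0 : Euc n) 1, ∀ t ∈ Icc (-1 : ℝ) 0, ‖b x t‖ ≤ B) →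
        (s < 1 / 2 →
          ContinuousOn (fun p : Euc n × ℝ => b p.1 p.2) (Metric.ball 0 1 ×ˢ Icc (-1) 0) ∧
          ∀ x ∈ Metric.ball (0 : Euc n) 1, ∀ y ∈ Metric.ball (0 : Euc n) 1,
            ∀ t ∈ Icc (-1 : ℝ) 0, ‖b x t - b y t‖ ≤ B * ‖x - y‖ ^ (1 - 2 * s)) →
        (∀ x ∈ Metric.ball (0 : Euc n) 1, ∀ t ∈ Icc (-1 : ℝ) 0, |f x t| ≤ F) →
        (∀ x : Euc n, ∀ t ∈ Icc (-1 : ℝ) 0, |u x t| ≤ U) →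
        IsClassicalSolution s b f u →
        ∀ x : Euc n, ∀ t ∈ Icc (-1 : ℝ) 0, ∀ ρ, ‖x‖ + B * |t| < ρ → |t| ≤ ρ ^ (2 * s) →
          |u x t - u 0 0| ≤ C * ρ ^ α * (U + F) := by
  obtain ⟨lam, α, ε₀, hl0, hl1, hα0, hα1, hε₀, hdec⟩ := oscillation_decay hn hs0 hs1 (B + 1)
  obtain ⟨r₀, hr₀, hr₀2, hr₀B⟩ := exists_initial_radius hs0 B
  have hlr : lam * r₀ ≤ 1 := mul_le_one₀ hl1.le hr₀.le (by linarith)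
  have hlr0 : 0 < lam * r₀ := by positivity
  have hinv : 1 ≤ (1 / (lam * r₀)) ^ α :=
    Real.one_le_rpow (by rwa [one_le_div hlr0]) hα0.le
  refine ⟨α, (2 + 2 / ε₀) * (1 / (lam * r₀)) ^ α, hα0, hα1, ?_, ?_⟩
  · have : 0 < 2 / ε₀ := by positivity
    nlinarith
  intro b f u U F hb hh hF hU hsol x t ht ρ hρ htρ
  have h0I : (0 : ℝ) ∈ Icc (-1 : ℝ) 0 := by simp
  have hF0 : 0 ≤ F := (abs_nonneg _).trans (hF 0 (by simp) 0 h0I)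
  have hU0 : 0 ≤ U := (abs_nonneg _).trans (hU 0 0 h0I)
  have hρ0 : 0 < ρ := lt_of_le_of_lt (by positivity) hρ
  have htriv : |u x t - u 0 0| ≤ 2 * U :=
    (abs_sub _ _).trans (by linarith [hU x t ht, hU 0 0 h0I])
  rcases (add_nonneg hU0 hF0).eq_or_lt with hz | hpos
  · rw [← hz, mul_zero]
    linarith
  -- Large enough for the initial oscillation 2U and for the forcing condition 2F ≤ ε₀M together.
  set M := (2 + 2 / ε₀) * (U + F) with hM
  have hM0 : 0 < M := by positivity
  have hMU : 2 * U ≤ M := by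
    have : 0 ≤ 2 / ε₀ * (U + F) := by positivity
    linarith
  have hMF : 2 * F ≤ ε₀ * M := by
    have : ε₀ * M = 2 * ε₀ * (U + F) + 2 * (U + F) := by
      rw [hM]
      field_simp
    rw [this]
    have : 0 ≤ 2 * ε₀ * (U + F) := by positivity
    linarith
  suffices h : |u x t - u 0 0| ≤ M * (ρ / (lam * r₀)) ^ α by
    refine h.trans_eq ?_
    rw [hM, div_eq_mul_one_div ρ, Real.mul_rpow hρ0.le (by positivity)]
    ring
  rcases le_or_gt r₀ ρ with hρr | hρr
  · refine htriv.trans (hMU.trans (le_mul_of_one_le_right hM0.le ?_))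
    refine Real.one_le_rpow ?_ hα0.le
    rw [one_le_div hlr0]
    nlinarith
  -- The scale satisfies λ^(k+1) r₀ < ρ ≤ λ^k r₀. Only k steps are needed, so the frame may be
  -- chosen after k; both points lie in its k-th cylinder.
  obtain ⟨k, hk1, hk2⟩ := exists_nat_pow_near_of_lt_one (x := ρ / r₀) (by positivity)
    ((div_le_one hr₀).2 hρr.le) hl0 hl1
  rw [lt_div_iff₀ hr₀] at hk1
  rw [div_le_iff₀ hr₀] at hk2
  set r := lam ^ k * r₀ with hr
  have hr0 : 0 < r := by positivity
  have hrr : ∀ j, lam ^ j * r₀ ≤ r₀ := fun j =>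
    mul_le_of_le_one_left hr₀.le (pow_le_one₀ hl0.le hl1.le)
  obtain ⟨V, V', hV, hVB, hVr, hdrift⟩ := exists_frame hs0 hB hr0 (hrr k) hr₀2 hr₀B hb hh
  obtain ⟨a, ha⟩ := hdec b f u U F M r₀ V V' k hsol hF hU hM0 hMU hMF hr₀ (by linarith) hV hVr
    fun j hj t ht x hx => hdrift _ (mul_le_mul_of_nonneg_right
      (pow_le_pow_of_le_one hl0.le hl1.le hj.le) hr₀.le) (hrr j) t ht x hx
  have hV0 : V 0 = 0 := by simpa using hVB 0
  have h1 := (ha t ⟨?_, ht.2⟩ x).1 ?_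
  · have h2 := (ha 0 ⟨by simp only [Left.neg_nonpos_iff]; positivity, le_rfl⟩ 0).1
      (by simpa [hV0] using hr0)
    have h3 : (lam ^ k) ^ α ≤ (ρ / (lam * r₀)) ^ α := by
      refine Real.rpow_le_rpow (by positivity) ?_ hα0.le
      rw [le_div_iff₀ hlr0]
      calc lam ^ k * (lam * r₀) = lam ^ (k + 1) * r₀ := by ring
        _ ≤ ρ := hk1.le
    have h4 : M * (lam ^ k) ^ α ≤ M * (ρ / (lam * r₀)) ^ α := by gcongr
    rw [abs_le]
    constructor <;> linarith [h1.1, h1.2, h2.1, h2.2]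
  · have h2 : ρ ^ (2 * s) ≤ r ^ (2 * s) := Real.rpow_le_rpow hρ0.le hk2 (by positivity)
    linarith [neg_abs_le t]
  · calc ‖x - V t‖ ≤ ‖x‖ + ‖V t‖ := norm_sub_le _ _
      _ ≤ ‖x‖ + B * |t| := by gcongr; exact hVB t
      _ < ρ := hρ
      _ ≤ r := hk2

/-- The parabolic size must dominate both |t|^(1/(2s)) and the displacement B|t| of the frame. For s
< 1/2 the displacement is the larger of the two near t = 0, and passing to the exponent ασ with σ =
min(1, 2s) accommodates it. -/
theorem mainTheorem2 (n : ℕ) (hn : 1 ≤ n) (s : ℝ) (hs0 : 0 < s) (hs1 : s < 1) (B : ℝ) :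
    ∃ α C : ℝ, 0 < α ∧ α < 1 ∧ 0 < C ∧
      ∀ (b : EuclideanSpace ℝ (Fin n) → ℝ → EuclideanSpace ℝ (Fin n))
        (f u : EuclideanSpace ℝ (Fin n) → ℝ → ℝ) (U F : ℝ),
        (∀ x ∈ Metric.ball (0 : EuclideanSpace ℝ (Fin n)) 1, ∀ t ∈ Icc (-1 : ℝ) 0,
          ‖b x t‖ ≤ B) →
        (s < 1 / 2 →
          ContinuousOn (fun p : EuclideanSpace ℝ (Fin n) × ℝ => b p.1 p.2)
            (Metric.ball 0 1 ×ˢ Icc (-1) 0) ∧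
          ∀ x ∈ Metric.ball (0 : EuclideanSpace ℝ (Fin n)) 1,
            ∀ y ∈ Metric.ball (0 : EuclideanSpace ℝ (Fin n)) 1, ∀ t ∈ Icc (-1 : ℝ) 0,
              ‖b x t - b y t‖ ≤ B * ‖x - y‖ ^ (1 - 2 * s)) →
        (∀ x ∈ Metric.ball (0 : EuclideanSpace ℝ (Fin n)) 1, ∀ t ∈ Icc (-1 : ℝ) 0,
          |f x t| ≤ F) →
        (∀ x : EuclideanSpace ℝ (Fin n), ∀ t ∈ Icc (-1 : ℝ) 0, |u x t| ≤ U) →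
        IsClassicalSolution s b f u →
        ∀ x : EuclideanSpace ℝ (Fin n), ∀ t ∈ Icc (-1 : ℝ) 0,
          |u x t - u 0 0| ≤ C * (‖x‖ ^ α + |t| ^ (α / (2 * s))) * (U + F) := by
  have h0I : (0 : ℝ) ∈ Icc (-1 : ℝ) 0 := by simp
  -- For negative B no drift satisfies the bound, so any constants will do.
  rcases lt_or_ge B 0 with hB | hB
  · refine ⟨1 / 2, 1, by norm_num, by norm_num, one_pos, fun b f u U F hb => ?_⟩
    exact absurd ((norm_nonneg _).trans (hb 0 (by simp) 0 h0I)) (not_le.2 hB)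
  obtain ⟨α, C, hα0, hα1, hC, hmain⟩ := holder_of_parabolic_size hn hs0 hs1 hB
  set σ := min 1 (2 * s) with hσ
  have hσ0 : 0 < σ := lt_min one_pos (by linarith)
  have hσ1 : σ ≤ 1 := min_le_left _ _
  have hσs : σ ≤ 2 * s := min_le_right _ _
  have h2s : 0 < 2 * s := by linarith
  refine ⟨α * σ, C * (B + 2), by positivity, by nlinarith, by positivity, ?_⟩
  intro b f u U F hb hh hF hU hsol x t ht
  have hF0 : 0 ≤ F := (abs_nonneg _).trans (hF 0 (by simp) 0 h0I)
  have hU0 : 0 ≤ U := (abs_nonneg _).trans (hU 0 0 h0I)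
  have ht1 : |t| ≤ 1 := by
    rw [abs_of_nonpos ht.2]
    linarith [ht.1]
  rcases le_or_gt ‖x‖ 1 with hx1 | hx1
  · by_cases hzero : x = 0 ∧ t = 0
    · rw [hzero.1, hzero.2, sub_self, abs_zero]
      positivity
    set T := |t| ^ (σ / (2 * s)) with hT
    have htT : |t| ≤ T := by
      rcases (abs_nonneg t).eq_or_lt with h' | h'
      · rw [← h']
        positivity
      · calc |t| = |t| ^ (1 : ℝ) := (Real.rpow_one _).symm
          _ ≤ T := Real.rpow_le_rpow_of_exponent_ge h' ht1 ((div_le_one h2s).2 hσs)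
    -- The coefficients 2 and B + 1 exceed those required by one, which makes the inequality strict
    -- away from the origin.
    have hρ1 : ‖x‖ + B * |t| < 2 * ‖x‖ + (B + 1) * T := by
      have e1 : B * |t| ≤ B * T := by gcongr
      rcases eq_or_ne x 0 with hx | hx
      · have : 0 < |t| := abs_pos.2 fun h' => hzero ⟨hx, h'⟩
        rw [hx, norm_zero]
        linarith
      · have : 0 < ‖x‖ := norm_pos_iff.2 hx
        linarith [abs_nonneg t]
    have hρ2 : |t| ≤ (2 * ‖x‖ + (B + 1) * T) ^ (2 * s) := by
      have e1 : |t| ≤ T ^ (2 * s) := by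
        rw [hT, ← Real.rpow_mul (abs_nonneg t), div_mul_cancel₀ _ h2s.ne']
        rcases (abs_nonneg t).eq_or_lt with h' | h'
        · rw [← h']
          positivity
        · calc |t| = |t| ^ (1 : ℝ) := (Real.rpow_one _).symm
            _ ≤ _ := Real.rpow_le_rpow_of_exponent_ge h' ht1 hσ1
      refine e1.trans (Real.rpow_le_rpow (by positivity) ?_ h2s.le)
      have : 0 ≤ B * T := by positivity
      linarith [norm_nonneg x]
    refine (hmain b f u U F hb hh hF hU hsol x t ht _ hρ1 hρ2).trans ?_
    have hadd : (2 * ‖x‖ + (B + 1) * T) ^ α ≤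
        (B + 2) * (‖x‖ ^ (α * σ) + |t| ^ (α * σ / (2 * s))) := by
      have hsub := Real.rpow_add_le_add_rpow (p := α) (a := 2 * ‖x‖) (b := (B + 1) * T)
        (by positivity) (by positivity) hα0.le hα1.le
      have e1 : (2 * ‖x‖) ^ α ≤ (B + 2) * ‖x‖ ^ (α * σ) := by
        rw [Real.mul_rpow (by norm_num) (norm_nonneg x)]
        have e2 : (2 : ℝ) ^ α ≤ B + 2 :=
          (Real.rpow_le_self_of_one_le (by norm_num) hα1.le).trans (by linarith)
        have e3 : ‖x‖ ^ α ≤ ‖x‖ ^ (α * σ) := by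
          rcases (norm_nonneg x).eq_or_lt with h' | h'
          · rw [← h', Real.zero_rpow hα0.ne']
            positivity
          · exact Real.rpow_le_rpow_of_exponent_ge h' hx1 (mul_le_of_le_one_right hα0.le hσ1)
        gcongr
      have e4 : ((B + 1) * T) ^ α ≤ (B + 2) * |t| ^ (α * σ / (2 * s)) := by
        rw [Real.mul_rpow (by positivity) (by positivity), hT, ← Real.rpow_mul (abs_nonneg t),
          show σ / (2 * s) * α = α * σ / (2 * s) by ring]
        have e2 : (B + 1) ^ α ≤ B + 2 :=
          (Real.rpow_le_self_of_one_le (by linarith) hα1.le).trans (by linarith)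
        gcongr
      rw [mul_add]
      exact hsub.trans (add_le_add e1 e4)
    rw [mul_assoc C (B + 2)]
    gcongr
  · have htriv : |u x t - u 0 0| ≤ 2 * U :=
      (abs_sub _ _).trans (by linarith [hU x t ht, hU 0 0 h0I])
    have e1 : 1 ≤ ‖x‖ ^ (α * σ) := Real.one_le_rpow hx1.le (by positivity)
    have e2 : 2 ≤ C * (B + 2) := by nlinarith
    have e3 : 0 ≤ |t| ^ (α * σ / (2 * s)) := by positivity
    calc |u x t - u 0 0| ≤ 2 * 1 * (U + F) := by linarith
      _ ≤ C * (B + 2) * (‖x‖ ^ (α * σ) + |t| ^ (α * σ / (2 * s))) * (U + F) := by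
        gcongr
        linarith
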